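/- Setting. Let $0\le q<1$ and $N\in\mathbb N$; time flows backwards, $N,N-1,\dots,1,0$. Let $A_1,\dots,A_N\sim N(0,q)$ and $B_1,\dots,B_N\sim N(0,1-q)$ be independent, $Z_i=A_i+B_i$. The outcome $X_0$ has a diffuse (flat) prior. At time $t$ the market receives the signal $X_t=X_0+\sum_{i=1}^t Z_i$ and the expert receives the private signal $Y_t=X_0+\sum_{i=1}^t B_i$; the expert also sees the market's signals. Thus, given the initial price $X_N=x$, the outcome is $X_0=x-\sum_{i=1}^N Z_i$. Let $K\subseteq\{1,\dots,N\}$ be a fixed set of allowed periods. At each $t\in K$ the expert may, depending (measurably) on the signals he has received so far and on his earlier predictions, either stay silent or announce a real number as the value of $Y_t$ (that is, announce the outcome distribution with this mean and variance $(1-q)t$). The prediction is truthful if he announces $Y_t$. The market is Bayesian and takes announcements at face value: at time $t$ its distribution of $X_0$ is the posterior given its signals $X_N,\dots,X_t$ and given $Y_s=a_s$ for every announcement $a_s$ made so far, silence being uninformative (for $q=0$, where an announcement may contradict the market's signals, the posterior is the limit of the posteriors for $q\downarrow0$). A prediction at $t$ that changes the density of the market's distribution from $f_{t-}$ to $f_{t+}$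 earns the reward $\log\bigl(f_{t+}(X_0)/f_{t-}(X_0)\bigr)$; silence earns $0$. The total reward is the sum over all predictions made. Theorem 1. For every initial price $x$ and every period $n\le N$, for almost every history of signals $(X_s,Y_s)_{n\le s\le N}$, and for every record of (possibly untruthful) announcements made before period $n$: conditionally on the history, the total reward from the predictions at periods $t\in K$, $t\le n$, of the policy that makes a truthful prediction at every such period is integrable; for every other policy the expectation of the total reward from these periods is well defined in $[-\infty,\infty)$ and is at most the expectation under that truthful policy. In particular ($n=N$), the expert maximizes his expected total reward by predicting at every allowed period and predicting truthfully each time. -/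

import Mathlib

open MeasureTheory ProbabilityTheory Filter Topology
open scoped NNReal ENNReal

noncomputable section

namespace ExpertPrediction

/-! Time is discrete and flows backwards: `N, N - 1, …, 1, 0`; the outcome `X₀` is revealed at
time `0`. -/

/-- Names of the signals: `Sum.inl t` is the market signal `X_t` (with `X_0` the outcome) and
`Sum.inr t` is the expert's signal `Y_t`. -/
abbrev Signal : Type := ℕ ⊕ ℕ

/-- A realization of all the signals. -/
abbrev Path : Type := Signal → ℝ

section Model

variable {Ω : Type*}

/-- The outcome `X_0`, when the market price at the initial period `N` is `x` and the random-walk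
steps are `Z_i = A_i + B_i`: the price at time `N` is `X_0 + Z_1 + … + Z_N = x`. -/
def outcome (N : ℕ) (x : ℝ) (A B : ℕ → Ω → ℝ) (ω : Ω) : ℝ :=
  x - ∑ i ∈ Finset.Icc 1 N, (A i ω + B i ω)

/-- The market signal `X_t = X_0 + Z_1 + … + Z_t`. -/
def marketSignal (N : ℕ) (x : ℝ) (A B : ℕ → Ω → ℝ) (t : ℕ) (ω : Ω) : ℝ :=
  outcome N x A B ω + ∑ i ∈ Finset.Icc 1 t, (A i ω + B i ω)

/-- The expert's private signal `Y_t = X_0 + B_1 + … + B_t`. -/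
def expertSignal (N : ℕ) (x : ℝ) (A B : ℕ → Ω → ℝ) (t : ℕ) (ω : Ω) : ℝ :=
  outcome N x A B ω + ∑ i ∈ Finset.Icc 1 t, B i ω

/-- The random realization of all signals. -/
def path (N : ℕ) (x : ℝ) (A B : ℕ → Ω → ℝ) (ω : Ω) : Path :=
  Sum.elim (fun t => marketSignal N x A B t ω) (fun t => expertSignal N x A B t ω)

end Model

/-! ### The expert's information and policies -/

/-- What the expert has observed at time `t`: the pairs `(X_s, Y_s)` for `t ≤ s ≤ N`
(all other entries are masked by `0`). -/
abbrev History : Type := ℕ → ℝ × ℝ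

/-- The history at time `t` along a path. -/
def history (N t : ℕ) (w : Path) : History := fun s =>
  if t ≤ s ∧ s ≤ N then (w (Sum.inl s), w (Sum.inr s)) else 0

/-- A policy says, for each period `t` and each history at `t`, whether the expert makes a
prediction (should `t` be an allowed period) and which mean he announces if he does. It is always
applied to `history N t w`, so it uses only signals received up to (and including) period `t`. -/
structure Policy where
  speaks : ℕ → Set History
  report : ℕ → History → ℝ
  measurableSet_speaks : ∀ t, MeasurableSet (speaks t)
  measurable_report : ∀ t, Measurable (report t)

/-- Predict at every (allowed) period and announce the true signal `Y_t`. -/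
def truthful : Policy where
  speaks _ := Set.univ
  report t h := (h t).2
  measurableSet_speaks _ := MeasurableSet.univ
  measurable_report t := (measurable_pi_apply t).snd

open Classical in
/-- The announcements made when `K` is the set of allowed periods, `past` records the announcements
made before period `n` (at times `t > n`), and the policy `σ` is followed from period `n` on;
`none` stands for silence. -/
def announcements (N : ℕ) (K : Finset ℕ) (n : ℕ) (past : ℕ → Option ℝ) (σ : Policy) (w : Path)
    (t : ℕ) : Option ℝ :=
  if n < t then past t
  else if t ∈ K ∧ history N t w ∈ σ.speaks t then some (σ.report t (history N t w))
  else none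

/-! ### The Bayesian market -/

/-- The value of `X_t` when the outcome is `z` and the other signals are given by `w`. -/
def marketValue (z : ℝ) (w : Path) (t : ℕ) : ℝ := if t = 0 then z else w (Sum.inl t)

/-- The value of `Y_t` when the outcome is `z` (`Y_0 = X_0`) and the other signals are given
by `w`. -/
def expertValue (z : ℝ) (w : Path) (t : ℕ) : ℝ := if t = 0 then z else w (Sum.inr t)

/-- The joint density of all signals `X_1, Y_1, …, X_N, Y_N` given that the outcome is `z`: the
increments `A_{i+1}` of `X - Y` are `N(0, q)`, the increments `B_{i+1}` of `Y` are `N(0, 1 - q)`,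
all independent. -/
def pathDensity (q : ℝ≥0) (N : ℕ) (z : ℝ) (w : Path) : ℝ≥0∞ :=
  ∏ i ∈ Finset.range N,
    (gaussianPDF 0 q
        ((marketValue z w (i + 1) - expertValue z w (i + 1))
          - (marketValue z w i - expertValue z w i))
      * gaussianPDF 0 (1 - q) (expertValue z w (i + 1) - expertValue z w i))

/-- The signals that the market has not observed at time `t` if the expert has announced his
signals at the times in `S`. -/
def hidden (N t : ℕ) (S : Finset ℕ) : Finset Signal :=
  (Finset.Ico 1 t).disjSum (Finset.Icc 1 N \ S)

/-- The likelihood of the outcome `z`: the joint density, given the outcome `z`, of the market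
signals `X_t, …, X_N` and of the expert signals `Y_s`, `s ∈ S`, at the values that `w` has for
them. The other signals are integrated out. -/
def likelihood (q : ℝ≥0) (N t : ℕ) (S : Finset ℕ) (w : Path) (z : ℝ) : ℝ≥0∞ :=
  lmarginal (fun _ => (volume : Measure ℝ)) (hidden N t S) (pathDensity q N z) w

/-- Bayes' rule with a diffuse prior on the outcome. -/
def bayesDensity (q : ℝ≥0) (N t : ℕ) (S : Finset ℕ) (w : Path) (z : ℝ) : ℝ :=
  (likelihood q N t S w z / ∫⁻ z', likelihood q N t S w z').toReal

/-- The density of the market's posterior distribution of the outcome. For `q > 0` this is Bayes'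
rule. For `q = 0` the signals have no joint density (`X_t = Y_t`) and an announcement may
contradict the market's signals; then the posterior is the limit for quality tending to `0`. -/
def posteriorDensity (q : ℝ≥0) (N t : ℕ) (S : Finset ℕ) (w : Path) (z : ℝ) : ℝ :=
  if q = 0 then limUnder (𝓝[>] (0 : ℝ≥0)) fun r => bayesDensity r N t S w z
  else bayesDensity q N t S w z

/-- What the market takes for the values of the signals: its own signals, and the expert's
announcements `a` at face value. -/
def perceived (w : Path) (a : ℕ → Option ℝ) : Path :=
  Sum.elim (fun s => w (Sum.inl s)) (fun s => (a s).getD 0)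

/-- The density of the market distribution at time `t` before a prediction at `t`: the market knows
`X_t, …, X_N` and the announcements made at times `s` with `t < s ≤ N`. -/
def densityBefore (q : ℝ≥0) (N : ℕ) (a : ℕ → Option ℝ) (w : Path) (t : ℕ) : ℝ → ℝ :=
  posteriorDensity q N t ((Finset.Ioc t N).filter fun s => (a s).isSome) (perceived w a)

/-- The density of the market distribution at time `t` after a prediction at `t`: the market knows
`X_t, …, X_N` and the announcements made at times `s` with `t ≤ s ≤ N`. -/
def densityAfter (q : ℝ≥0) (N : ℕ) (a : ℕ → Option ℝ) (w : Path) (t : ℕ) : ℝ → ℝ :=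
  posteriorDensity q N t ((Finset.Icc t N).filter fun s => (a s).isSome) (perceived w a)

/-! ### Rewards and expectations -/

/-- The reward for period `t`: the logarithmic score `log (f₊(x₀) / f₋(x₀))` if a prediction is
made, `0` otherwise. -/
def periodReward (q : ℝ≥0) (N : ℕ) (a : ℕ → Option ℝ) (w : Path) (t : ℕ) : ℝ :=
  if (a t).isSome then
    Real.log (densityAfter q N a w t (w (Sum.inl 0)) / densityBefore q N a w t (w (Sum.inl 0)))
  else 0

/-- The total reward for all predictions made at time `n` or later (`t ≤ n`), when `σ` is followed
from period `n` on, after the announcements `past`. -/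
def totalReward (q : ℝ≥0) (N : ℕ) (K : Finset ℕ) (n : ℕ) (past : ℕ → Option ℝ) (σ : Policy)
    (w : Path) : ℝ :=
  ∑ t ∈ K.filter (fun t => t ≤ n), periodReward q N (announcements N K n past σ w) w t

/-- The expectation of a real random variable, with values in `[-∞, ∞]`: the expectation of the
positive part minus that of the negative part. It is meaningful if one of these is finite. -/
def extExpectation {α : Type*} [MeasurableSpace α] (μ : Measure α) (R : α → ℝ) : EReal :=
  ((∫⁻ a, ENNReal.ofReal (R a) ∂μ : ℝ≥0∞) : EReal)
    - ((∫⁻ a, ENNReal.ofReal (-R a) ∂μ : ℝ≥0∞) : EReal)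

/-- The expert's belief about the whole path given his history at time `n`: the regular conditional
distribution of the path of all signals given the history. -/
def expertBelief {Ω : Type*} [MeasurableSpace Ω] (P : Measure Ω) [IsFiniteMeasure P]
    (N : ℕ) (x : ℝ) (A B : ℕ → Ω → ℝ) (n : ℕ) : Kernel History Path :=
  condDistrib (path N x A B) (fun ω => history N n (path N x A B ω)) P

end ExpertPrediction

end

open ExpertPrediction

namespace ExpertPrediction

/-! ### Marginals of Gaussian random walks -/

section Marginal

variable {δ : Type*}

/-! A reward is a difference of two log densities at the outcome, at one time but for two records of
announcements. Abel summation (`sum_periodReward_eq`) regroups the total by record: apart from a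
boundary term fixed by the past announcements, it is the sum over the allowed periods t of log
f_t(X_0) - log f_s(X_0), where s is the next allowed period (or 0) and both densities use the
announcements made up to t. By Bayes' rule this difference is the log density of the market's
forecast at t of its own signal X_s, up to a term free of announcements (`logScore_sub_logScore`).
So each period pays, in effect, a logarithmic score for the forecast of X_s.

The walks X and Y - (1-q)X are independent, so the market's posterior depends on the announcements
only through the latest one (`likelihood_of_isLeast`, `posteriorDensity_eq`). A truthful
announcement therefore supersedes all earlier ones and makes the market's forecast of X_s agree with
the expert's conditional law of X_s (`forecast_of_isLeast`). As the logarithmic score is proper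
(`integral_scoreGap_nonpos`), truth maximizes every summand conditionally on the history at its
time, whatever was announced before; no lie can gain later what it loses now.

The expert's belief is computed from Gaussian orthogonality: the path is a linear forecast plus an
error independent of the history (`IsStepModel.expertBelief_eq`). A policy may have reward of
expectation -∞, but each summand exceeds its truthful value by at most an integrable amount, which
suffices for `extExpectation_add_sum_le`. -/

theorem gaussianPDF_mul_gaussianPDF {a b : ℝ≥0} (ha : a ≠ 0) (hb : b ≠ 0) (u v : ℝ) :
    gaussianPDF 0 a u * gaussianPDF 0 b v = gaussianPDF 0 (a + b) (u + v) *
      gaussianPDF 0 (a * b / (a + b)) (v - b / (a + b) * (u + v)) := by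
  have ha' : (0 : ℝ) < a := by positivity
  have hb' : (0 : ℝ) < b := by positivity
  simp only [gaussianPDF]
  rw [← ENNReal.ofReal_mul (gaussianPDFReal_nonneg _ _ _),
    ← ENNReal.ofReal_mul (gaussianPDFReal_nonneg _ _ _)]
  congr 1
  simp only [gaussianPDFReal, NNReal.coe_add, NNReal.coe_div, NNReal.coe_mul]
  rw [mul_mul_mul_comm, mul_mul_mul_comm (√(2 * Real.pi * (a + b)))⁻¹, ← Real.exp_add,
    ← Real.exp_add, ← mul_inv, ← mul_inv, ← Real.sqrt_mul (by positivity),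
    ← Real.sqrt_mul (by positivity)]
  congr 1
  · congr 2
    field_simp
  · congr 1
    field_simp
    ring

theorem gaussianPDF_ne_zero {v : ℝ≥0} (hv : v ≠ 0) (μ x : ℝ) : gaussianPDF μ v x ≠ 0 :=
  (gaussianPDF_pos μ hv x).ne'

theorem gaussianPDF_ne_top (μ : ℝ) (v : ℝ≥0) (x : ℝ) : gaussianPDF μ v x ≠ ⊤ :=
  ENNReal.ofReal_ne_top

theorem gaussianPDF_zero_le (v : ℝ≥0) (x : ℝ) :
    gaussianPDF 0 v x ≤ ENNReal.ofReal (√(2 * Real.pi * v))⁻¹ := by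
  refine ENNReal.ofReal_le_ofReal ?_
  rw [gaussianPDFReal]
  refine mul_le_of_le_one_right (by positivity) (Real.exp_le_one_iff.2 ?_)
  exact div_nonpos_of_nonpos_of_nonneg (by nlinarith [sq_nonneg (x - 0)]) (by positivity)

theorem lintegral_gaussianPDF_add {v : ℝ≥0} (hv : v ≠ 0) (c : ℝ) :
    ∫⁻ y, gaussianPDF 0 v (y + c) = 1 := by
  rw [lintegral_add_right_eq_self (fun y => gaussianPDF 0 v y) c]
  exact lintegral_gaussianPDF_eq_one 0 hv

/-- Convolution of Gaussians. The shift `c` is there because a walk position equals its coordinate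
only up to a shift (`IsWalk`). -/
theorem lintegral_gaussianPDF_sub_mul {a b : ℝ≥0} (ha : a ≠ 0) (hb : b ≠ 0) (r s c : ℝ) :
    ∫⁻ y, gaussianPDF 0 a (s - (c + y)) * gaussianPDF 0 b ((c + y) - r) =
      gaussianPDF 0 (a + b) (s - r) := by
  have hab : a * b / (a + b) ≠ 0 := by positivity
  have h : ∀ y : ℝ, gaussianPDF 0 a (s - (c + y)) * gaussianPDF 0 b ((c + y) - r) =
      gaussianPDF 0 (a + b) (s - r) *
        gaussianPDF 0 (a * b / (a + b)) (y + (c - r - b / (a + b) * (s - r))) := by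
    intro y
    rw [gaussianPDF_mul_gaussianPDF ha hb]
    congr 2 <;> ring
  simp_rw [h]
  rw [lintegral_const_mul _ (by fun_prop), lintegral_gaussianPDF_add hab, mul_one]

theorem apply_update_of_dependsOn [DecidableEq δ] {β : Type*} {f : (δ → ℝ) → β} {T : Set δ}
    (hf : DependsOn f T) {i : δ} (hi : i ∉ T) (w : δ → ℝ) (y : ℝ) : f (Function.update w i y) = f w :=
  hf fun j hj => Function.update_of_ne (by rintro rfl; exact hi hj) _ _

variable [DecidableEq δ]

theorem lmarginal_mul_of_dependsOn {s : Finset δ} {f g : (δ → ℝ) → ℝ≥0∞} {T : Set δ}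
    (hf : DependsOn f T) (hT : ∀ i ∈ s, i ∉ T) (hg : Measurable g) :
    lmarginal (fun _ => (volume : Measure ℝ)) s (fun w => f w * g w) =
      fun w => f w * lmarginal (fun _ => (volume : Measure ℝ)) s g w := by
  funext w
  have h : ∀ y : s → ℝ, f (Function.updateFinset w s y) = f w := fun y => hf fun j hj => by
    have : j ∉ s := fun hjs => hT j hjs hj
    simp [Function.updateFinset, this]
  simp only [lmarginal, h]
  exact lintegral_const_mul _ (hg.comp measurable_updateFinset)

theorem dependsOn_lmarginal {s : Finset δ} {f : (δ → ℝ) → ℝ≥0∞} {T : Set δ}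
    (hf : DependsOn f T) :
    DependsOn (lmarginal (fun _ => (volume : Measure ℝ)) s f) T := by
  intro x y hxy
  refine lintegral_congr fun u => hf fun j hj => ?_
  by_cases h : j ∈ s <;> simp [Function.updateFinset, h, hxy j hj]

end Marginal

/-! ### Integrating out positions of a Gaussian random walk -/

section Walk

variable {δ : Type*}

/-- The density of the steps from `m` to `k` of a Gaussian random walk with position `p i w` at
time `i` and variance `v` per step. -/
noncomputable def stepsDensity (v : ℝ≥0) (p : ℕ → (δ → ℝ) → ℝ) (m k : ℕ) (w : δ → ℝ) : ℝ≥0∞ :=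
  ∏ i ∈ Finset.Ico m k, gaussianPDF 0 v (p (i + 1) w - p i w)

/-- The position at time `i` is, up to a shift by a function of the coordinates off the walk, the
coordinate `e i`. -/
structure IsWalk [DecidableEq δ] (e : ℕ → δ) (p : ℕ → (δ → ℝ) → ℝ) : Prop where
  injective : Function.Injective e
  measurable : ∀ i, Measurable (p i)
  dependsOn : ∀ i, DependsOn (p i) {σ | ∀ j, σ = e j → j = i}
  update : ∀ j, 1 ≤ j → ∀ w y, p j (Function.update w (e j) y) = p j w + (y - w (e j))

variable {e : ℕ → δ} {p : ℕ → (δ → ℝ) → ℝ} {v : ℝ≥0}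

theorem stepsDensity_succ {m k : ℕ} (h : m ≤ k) (w : δ → ℝ) :
    stepsDensity v p m (k + 1) w =
      gaussianPDF 0 v (p (k + 1) w - p k w) * stepsDensity v p m k w := by
  rw [stepsDensity, Finset.prod_Ico_succ_top h, mul_comm]; rfl

theorem stepsDensity_mul {m k l : ℕ} (h : m ≤ k) (h' : k ≤ l) (w : δ → ℝ) :
    stepsDensity v p m k w * stepsDensity v p k l w = stepsDensity v p m l w :=
  Finset.prod_Ico_consecutive _ h h'

theorem stepsDensity_ne_zero (hv : v ≠ 0) (m k : ℕ) (w : δ → ℝ) : stepsDensity v p m k w ≠ 0 :=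
  Finset.prod_ne_zero_iff.2 fun _ _ => gaussianPDF_ne_zero hv _ _

theorem stepsDensity_ne_top (m k : ℕ) (w : δ → ℝ) : stepsDensity v p m k w ≠ ⊤ :=
  ENNReal.prod_ne_top fun _ _ => gaussianPDF_ne_top _ _ _

theorem measurable_stepsDensity (hp : ∀ i, Measurable (p i)) (m k : ℕ) :
    Measurable (stepsDensity v p m k) :=
  Finset.measurable_fun_prod _ fun i _ => (measurable_gaussianPDF 0 v).comp ((hp _).sub (hp _))

theorem dependsOn_stepsDensity {T : Set δ} {m k : ℕ}
    (h : ∀ i, m ≤ i → i ≤ k → DependsOn (p i) T) : DependsOn (stepsDensity v p m k) T := by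
  intro x y hxy
  refine Finset.prod_congr rfl fun i hi => ?_
  rw [Finset.mem_Ico] at hi
  rw [h i hi.1 hi.2.le hxy, h (i + 1) (by omega) (by omega) hxy]

variable [DecidableEq δ]

theorem IsWalk.apply_update (hp : IsWalk e p) {i j : ℕ} (h : j ≠ i) (w : δ → ℝ) (y : ℝ) :
    p i (Function.update w (e j) y) = p i w :=
  apply_update_of_dependsOn (hp.dependsOn i) (fun h' => h (h' j rfl)) w y

/-- Chapman–Kolmogorov: integrating out the interior positions leaves the transition density of `k +
1` steps. -/
theorem IsWalk.lmarginal_stepsDensity (hp : IsWalk e p) (hv : v ≠ 0) (k : ℕ) :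
    lmarginal (fun _ => (volume : Measure ℝ)) ((Finset.Icc 1 k).image e)
        (stepsDensity v p 0 (k + 1)) =
      fun w => gaussianPDF 0 ((k + 1 : ℕ) * v) (p (k + 1) w - p 0 w) := by
  induction k with
  | zero => funext w; simp [stepsDensity]
  | succ k ih =>
    have hins : (Finset.Icc 1 (k + 1)).image e =
        insert (e (k + 1)) ((Finset.Icc 1 k).image e) := by
      rw [← Finset.image_insert]; congr 1; ext; simp; omega
    have hnot : e (k + 1) ∉ (Finset.Icc 1 k).image e := by
      simp only [Finset.mem_image, Finset.mem_Icc, not_exists, not_and]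
      intro i hi h; have := hp.injective h; omega
    have hm := measurable_stepsDensity (v := v) hp.measurable
    funext w
    rw [hins, lmarginal_insert _ (hm _ _) hnot]
    have hfun : stepsDensity v p 0 (k + 1 + 1) = fun w =>
        gaussianPDF 0 v (p (k + 1 + 1) w - p (k + 1) w) * stepsDensity v p 0 (k + 1) w := by
      funext w; exact stepsDensity_succ (by omega) w
    have hdep : DependsOn (fun w => gaussianPDF 0 v (p (k + 1 + 1) w - p (k + 1) w))
        {σ | ∀ j, σ = e j → k + 1 ≤ j} := by
      intro x y hxy
      dsimp only
      rw [hp.dependsOn (k + 1 + 1) fun i hi => hxy i fun j hj => by have := hi j hj; omega,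
        hp.dependsOn (k + 1) fun i hi => hxy i fun j hj => by have := hi j hj; omega]
    rw [hfun, lmarginal_mul_of_dependsOn hdep _ (hm _ _), ih]
    · have hk : ((k + 1 : ℕ) : ℝ≥0) * v ≠ 0 := mul_ne_zero (by positivity) hv
      -- By `IsWalk.update`, the position at time `k + 1` is the integrated coordinate plus the
      -- shift given as the last argument.
      have := lintegral_gaussianPDF_sub_mul hv hk (p 0 w) (p (k + 1 + 1) w)
        (p (k + 1) w - w (e (k + 1)))
      rw [show v + ((k + 1 : ℕ) : ℝ≥0) * v = ((k + 1 + 1 : ℕ) : ℝ≥0) * v by push_cast; ring]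
        at this
      rw [← this]
      refine lintegral_congr fun y => ?_
      dsimp only
      rw [hp.apply_update (i := k + 1 + 1) (by omega), hp.apply_update (i := 0) (by omega),
        hp.update _ (by omega)]
      congr 2 <;> ring
    · intro i hi h
      obtain ⟨j, hj, rfl⟩ := Finset.mem_image.1 hi
      have := h j rfl
      rw [Finset.mem_Icc] at hj; omega

theorem IsWalk.lmarginal_stepsDensity_eq_one (hp : IsWalk e p) (hv : v ≠ 0) {N : ℕ} (hN : 1 ≤ N) :
    lmarginal (fun _ => (volume : Measure ℝ)) ((Finset.Icc 1 N).image e)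
        (stepsDensity v p 0 N) = fun _ => 1 := by
  obtain ⟨k, rfl⟩ : ∃ k, N = k + 1 := ⟨N - 1, by omega⟩
  have hins : (Finset.Icc 1 (k + 1)).image e =
      insert (e (k + 1)) ((Finset.Icc 1 k).image e) := by
    rw [← Finset.image_insert]; congr 1; ext; simp; omega
  have hnot : e (k + 1) ∉ (Finset.Icc 1 k).image e := by
    simp only [Finset.mem_image, Finset.mem_Icc, not_exists, not_and]
    intro i hi h; have := hp.injective h; omega
  funext w
  rw [hins, lmarginal_insert _ (measurable_stepsDensity hp.measurable _ _) hnot,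
    hp.lmarginal_stepsDensity hv]
  have hk : ((k + 1 : ℕ) : ℝ≥0) * v ≠ 0 := mul_ne_zero (by positivity) hv
  rw [← lintegral_gaussianPDF_add hk (p (k + 1) w - w (e (k + 1)) - p 0 w)]
  refine lintegral_congr fun y => ?_
  dsimp only
  rw [hp.apply_update (i := 0) (by omega), hp.update _ (by omega)]
  congr 1; ring

/-- Used only to see that the constant in `likelihood_of_isLeast` is finite. The last step is peeled
off: it integrates to one if its endpoint is hidden, and is otherwise bounded by the maximum of the
Gaussian density. -/
theorem IsWalk.exists_lmarginal_stepsDensity_le (hp : IsWalk e p) (hv : v ≠ 0) {m N : ℕ}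
    (hmN : m ≤ N) (H : Finset ℕ) (hH : H ⊆ Finset.Ioc m N) :
    ∃ C : ℝ≥0∞, C ≠ ⊤ ∧ ∀ w, lmarginal (fun _ => (volume : Measure ℝ)) (H.image e)
        (stepsDensity v p m N) w ≤ C := by
  induction N, hmN using Nat.le_induction generalizing H with
  | base =>
    have : H = ∅ := by simpa using hH
    subst this
    exact ⟨1, by simp, fun w => by simp [stepsDensity]⟩
  | succ N hmN ih =>
    have hm := measurable_stepsDensity (v := v) hp.measurable
    by_cases hN : N + 1 ∈ H
    · obtain ⟨C, hC, hle⟩ := ih (H.erase (N + 1)) (by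
        intro i hi
        rw [Finset.mem_erase] at hi
        have := Finset.mem_Ioc.1 (hH hi.2)
        rw [Finset.mem_Ioc]; omega)
      refine ⟨C, hC, fun w => ?_⟩
      have hnot : e (N + 1) ∉ (H.erase (N + 1)).image e := by
        simp only [Finset.mem_image, not_exists, not_and]
        intro i hi h; have := hp.injective h; subst this; simp at hi
      rw [← Finset.insert_erase hN, Finset.image_insert, lmarginal_insert' _ (hm _ _) hnot]
      refine le_of_eq_of_le (congrFun (congrArg _ ?_) w) (hle w)
      funext x
      have h1 : ∀ y, stepsDensity v p m (N + 1) (Function.update x (e (N + 1)) y) =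
          stepsDensity v p m N x *
            gaussianPDF 0 v (y + (p (N + 1) x - x (e (N + 1)) - p N x)) := by
        intro y
        rw [stepsDensity_succ hmN, mul_comm, hp.apply_update (i := N) (by omega),
          hp.update _ (by omega)]
        congr 1
        · refine Finset.prod_congr rfl fun i hi => ?_
          rw [Finset.mem_Ico] at hi
          rw [hp.apply_update (i := i) (by omega), hp.apply_update (i := i + 1) (by omega)]
        · congr 1; ring
      simp_rw [h1]
      rw [lintegral_const_mul _ (by fun_prop), lintegral_gaussianPDF_add hv, mul_one]
    · obtain ⟨C, hC, hle⟩ := ih H (by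
        intro i hi
        have := Finset.mem_Ioc.1 (hH hi)
        have h2 : i ≠ N + 1 := fun h => hN (h ▸ hi)
        rw [Finset.mem_Ioc]; omega)
      refine ⟨ENNReal.ofReal (√(2 * Real.pi * v))⁻¹ * C,
        ENNReal.mul_ne_top ENNReal.ofReal_ne_top hC,
        fun w => ?_⟩
      have h1 : stepsDensity v p m (N + 1) ≤
          fun w => ENNReal.ofReal (√(2 * Real.pi * v))⁻¹ * stepsDensity v p m N w := by
        intro w; rw [stepsDensity_succ hmN]; exact mul_le_mul_left (gaussianPDF_zero_le _ _) _
      refine (lmarginal_mono h1 w).trans ?_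
      rw [lmarginal_mul_of_dependsOn (T := ∅) (fun _ _ _ => rfl) (by simp) (hm _ _)]
      exact mul_le_mul_right (hle w) _

theorem lmarginal_ne_zero {s : Finset δ} {f : (δ → ℝ) → ℝ≥0∞} (hf : Measurable f)
    (h : ∀ w, f w ≠ 0) (w : δ → ℝ) :
    lmarginal (fun _ => (volume : Measure ℝ)) s f w ≠ 0 := by
  intro h0
  rw [lmarginal] at h0
  have h0 := (lintegral_eq_zero_iff (hf.comp measurable_updateFinset)).1 h0
  obtain ⟨y, hy⟩ := h0.exists
  exact h _ hy

end Walk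

/-! ### The likelihood of the outcome -/

/-- The value of `Y_t - (1 - q) X_t` when the outcome is `z`. -/
noncomputable def innovation (q : ℝ≥0) (z : ℝ) (t : ℕ) (w : Path) : ℝ :=
  expertValue z w t - (1 - q) * marketValue z w t

theorem measurable_marketValue (z : ℝ) (t : ℕ) : Measurable fun w => marketValue z w t := by
  unfold marketValue
  split_ifs <;> fun_prop

theorem measurable_expertValue (z : ℝ) (t : ℕ) : Measurable fun w => expertValue z w t := by
  unfold expertValue
  split_ifs <;> fun_prop

theorem isWalk_marketValue (z : ℝ) :
    IsWalk (Sum.inl : ℕ → Signal) (fun i w => marketValue z w i) where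
  injective := Sum.inl_injective
  measurable := measurable_marketValue z
  dependsOn i x y hxy := by
    have := hxy (Sum.inl i) (by simp)
    simp [marketValue, this]
  update j hj w y := by
    have : j ≠ 0 := by omega
    simp [marketValue, this]

theorem isWalk_innovation (q : ℝ≥0) (z : ℝ) :
    IsWalk (Sum.inr : ℕ → Signal) (innovation q z) where
  injective := Sum.inr_injective
  measurable i := (measurable_expertValue z i).sub ((measurable_marketValue z i).const_mul _)
  dependsOn i x y hxy := by
    have h1 := hxy (Sum.inr i) (by simp)
    have h2 := hxy (Sum.inl i) (by simp)
    simp [innovation, expertValue, marketValue, h1, h2]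
  update j hj w y := by
    have : j ≠ 0 := by omega
    simp [innovation, expertValue, marketValue, this]

/-- With Z = A + B, the residual B - (1-q)Z of the regression of B on Z is independent of Z and has
variance q(1-q). Hence X and Y - (1-q)X are independent walks, which `gaussianPDF_mul_gaussianPDF`
expresses for one step. -/
theorem pathDensity_eq {q : ℝ≥0} (hq0 : q ≠ 0) (hq : q < 1) (N : ℕ) (z : ℝ) (w : Path) :
    pathDensity q N z w = stepsDensity 1 (fun i w => marketValue z w i) 0 N w *
      stepsDensity (q * (1 - q)) (innovation q z) 0 N w := by
  have hq1 : 1 - q ≠ 0 := (tsub_pos_of_lt hq).ne'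
  have hsum : q + (1 - q) = 1 := add_tsub_cancel_of_le hq.le
  rw [pathDensity, stepsDensity, stepsDensity, ← Finset.prod_mul_distrib, Finset.range_eq_Ico]
  refine Finset.prod_congr rfl fun i _ => ?_
  rw [gaussianPDF_mul_gaussianPDF hq0 hq1, hsum]
  have h2 : (q : ℝ) + ((1 - q : ℝ≥0) : ℝ) = 1 := by exact_mod_cast hsum
  have h3 : ((1 - q : ℝ≥0) : ℝ) = 1 - q := NNReal.coe_sub hq.le
  rw [h2, h3]
  simp only [innovation, div_one]
  congr 2 <;> ring

theorem hidden_eq (N t : ℕ) (S : Finset ℕ) :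
    hidden N t S = (Finset.Ico 1 t).image Sum.inl ∪ (Finset.Icc 1 N \ S).image Sum.inr := by
  ext σ
  rcases σ with i | i <;> simp [hidden]

theorem disjoint_image_inl_inr (s t : Finset ℕ) :
    Disjoint (s.image (Sum.inl : ℕ → Signal)) (t.image Sum.inr) := by
  rw [Finset.disjoint_left]
  rintro (i | i) <;> simp

theorem dependsOn_marketValue_inl (z : ℝ) (i : ℕ) {T : Set Signal} (h : Sum.inl i ∈ T) :
    DependsOn (fun w => marketValue z w i) T := fun x y hxy => by
  simp [marketValue, hxy _ h]

theorem dependsOn_innovation (q : ℝ≥0) (z : ℝ) (i : ℕ) {T : Set Signal} (h : Sum.inl i ∈ T)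
    (h' : Sum.inr i ∈ T) : DependsOn (innovation q z i) T := fun x y hxy => by
  simp [innovation, marketValue, expertValue, hxy _ h, hxy _ h']

theorem stepsDensity_marketValue_eq {t : ℕ} (ht : 1 ≤ t) (N : ℕ) (z z' : ℝ) (w : Path) :
    stepsDensity 1 (fun i w => marketValue z w i) t N w =
      stepsDensity 1 (fun i w => marketValue z' w i) t N w := by
  refine Finset.prod_congr rfl fun i hi => ?_
  have : i ≠ 0 := by rw [Finset.mem_Ico] at hi; omega
  simp [marketValue, this]

theorem stepsDensity_innovation_eq {q v : ℝ≥0} {t : ℕ} (ht : 1 ≤ t) (N : ℕ) (z z' : ℝ) :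
    stepsDensity v (innovation q z) t N = stepsDensity v (innovation q z') t N := by
  funext w
  refine Finset.prod_congr rfl fun i hi => ?_
  have : i ≠ 0 := by rw [Finset.mem_Ico] at hi; omega
  simp [innovation, marketValue, expertValue, this]

theorem lmarginal_marketValue {t N : ℕ} (ht : 1 ≤ t) (htN : t ≤ N) (z : ℝ) :
    lmarginal (fun _ => (volume : Measure ℝ)) ((Finset.Ico 1 t).image (Sum.inl : ℕ → Signal))
        (stepsDensity 1 (fun i w => marketValue z w i) 0 N) = fun w =>
      stepsDensity 1 (fun i w => marketValue z w i) t N w *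
        gaussianPDF 0 t (w (Sum.inl t) - z) := by
  obtain ⟨k, rfl⟩ : ∃ k, t = k + 1 := ⟨t - 1, by omega⟩
  have hm := measurable_stepsDensity (v := 1) (measurable_marketValue z)
  have hfun : stepsDensity 1 (fun i w => marketValue z w i) 0 N = fun w =>
      stepsDensity 1 (fun i w => marketValue z w i) (k + 1) N w *
        stepsDensity 1 (fun i w => marketValue z w i) 0 (k + 1) w := by
    funext w
    rw [mul_comm, stepsDensity_mul (by omega) htN]
  have hdep : DependsOn (stepsDensity 1 (fun i w => marketValue z w i) (k + 1) N)
      {σ : Signal | ∀ j, σ = Sum.inl j → k + 1 ≤ j} :=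
    dependsOn_stepsDensity fun i hi _ => dependsOn_marketValue_inl z i (by
      intro j hj; rw [Sum.inl.injEq] at hj; omega)
  rw [hfun, lmarginal_mul_of_dependsOn hdep _ (hm _ _),
    show Finset.Ico 1 (k + 1) = Finset.Icc 1 k from rfl,
    (isWalk_marketValue z).lmarginal_stepsDensity one_ne_zero]
  · funext w
    simp [marketValue]
  · intro i hi h
    obtain ⟨j, hj, rfl⟩ := Finset.mem_image.1 hi
    have := h j rfl
    rw [Finset.mem_Ico] at hj; omega

variable {q : ℝ≥0}

theorem likelihood_empty (hq0 : q ≠ 0) (hq : q < 1) {t N : ℕ} (ht : 1 ≤ t) (htN : t ≤ N)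
    (w : Path) : ∃ C : ℝ≥0∞, C ≠ 0 ∧ C ≠ ⊤ ∧ ∀ z, likelihood q N t ∅ w z =
      C * gaussianPDF 0 t (w (Sum.inl t) - z) := by
  have hv : q * (1 - q) ≠ 0 := mul_ne_zero hq0 (tsub_pos_of_lt hq).ne'
  refine ⟨stepsDensity 1 (fun i w => marketValue 0 w i) t N w,
    stepsDensity_ne_zero one_ne_zero _ _ _, stepsDensity_ne_top _ _ _, fun z => ?_⟩
  have hX := measurable_stepsDensity (v := 1) (measurable_marketValue z)
  have hU := measurable_stepsDensity (v := q * (1 - q)) (isWalk_innovation q z).measurable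
  have hdep : DependsOn (stepsDensity 1 (fun i w => marketValue z w i) 0 N)
      {σ : Signal | ∀ j, σ ≠ Sum.inr j} :=
    dependsOn_stepsDensity fun i _ _ => dependsOn_marketValue_inl z i (by simp)
  have hfull : Measurable fun w => stepsDensity 1 (fun i w => marketValue z w i) 0 N w *
      stepsDensity (q * (1 - q)) (innovation q z) 0 N w := (hX _ _).mul (hU _ _)
  rw [likelihood, hidden_eq, Finset.sdiff_empty, funext (pathDensity_eq hq0 hq N z),
    lmarginal_union _ _ hfull (disjoint_image_inl_inr _ _),
    lmarginal_mul_of_dependsOn hdep _ (hU _ _),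
    (isWalk_innovation q z).lmarginal_stepsDensity_eq_one hv (by omega)]
  · simp only [mul_one]
    rw [lmarginal_marketValue ht htN]
    dsimp only
    rw [stepsDensity_marketValue_eq ht N z 0]
  · intro i hi h
    obtain ⟨j, hj, rfl⟩ := Finset.mem_image.1 hi
    exact h j rfl

/-- The innovation Y - (1-q)X starts at qz and is Markov: its values at times after `r` (seen
earlier, as time flows backwards) contribute only a factor free of `z`. What remains is the law of
its `r` steps, next to that of the `t` steps of X. -/
theorem likelihood_of_isLeast (hq0 : q ≠ 0) (hq : q < 1) {t N r : ℕ} (ht : 1 ≤ t) (htN : t ≤ N)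
    {S : Finset ℕ} (hS : S ⊆ Finset.Icc t N) (hr : IsLeast (S : Set ℕ) r)
    (w : Path) : ∃ C : ℝ≥0∞, C ≠ 0 ∧ C ≠ ⊤ ∧ ∀ z, likelihood q N t S w z =
      C * (gaussianPDF 0 t (w (Sum.inl t) - z) *
        gaussianPDF 0 (r * (q * (1 - q)))
          (w (Sum.inr r) - (1 - q) * w (Sum.inl r) - q * z)) := by
  have hv : q * (1 - q) ≠ 0 := mul_ne_zero hq0 (tsub_pos_of_lt hq).ne'
  have hrS : r ∈ S := hr.1
  have htr : t ≤ r ∧ r ≤ N := Finset.mem_Icc.1 (hS hrS)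
  obtain ⟨k, rfl⟩ : ∃ k, r = k + 1 := ⟨r - 1, by omega⟩
  set up : Finset ℕ := Finset.Ioc (k + 1) N \ S with hup
  set D : ℝ → Path → ℝ≥0∞ := fun z => lmarginal (fun _ => (volume : Measure ℝ))
    (up.image (Sum.inr : ℕ → Signal)) (stepsDensity (q * (1 - q)) (innovation q z) (k + 1) N)
    with hD
  have hDz : ∀ z, D z = D 0 := fun z => by
    simp only [hD]; rw [stepsDensity_innovation_eq (by omega) N z 0]
  have hU := fun z => measurable_stepsDensity (v := q * (1 - q)) (isWalk_innovation q z).measurable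
  -- The factor `D` of the steps above `r` does not involve `z`, since the outcome enters the
  -- signals only at time 0.
  obtain ⟨B, hB, hDle⟩ := (isWalk_innovation q 0).exists_lmarginal_stepsDensity_le hv htr.2 up
    Finset.sdiff_subset
  refine ⟨stepsDensity 1 (fun i w => marketValue 0 w i) t N w * D 0 w,
    mul_ne_zero (stepsDensity_ne_zero one_ne_zero _ _ _)
      (lmarginal_ne_zero (hU 0 _ _) (stepsDensity_ne_zero hv _ _) w),
    ENNReal.mul_ne_top (stepsDensity_ne_top _ _ _) (ne_top_of_le_ne_top hB (hDle w)),
    fun z => ?_⟩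
  have hX := measurable_stepsDensity (v := 1) (measurable_marketValue z)
  have hUz := hU z
  have hsplit : (Finset.Icc 1 N \ S).image (Sum.inr : ℕ → Signal) =
      up.image Sum.inr ∪ (Finset.Icc 1 k).image Sum.inr := by
    rw [← Finset.image_union]
    congr 1
    ext i
    simp only [hup, Finset.mem_sdiff, Finset.mem_union, Finset.mem_Icc, Finset.mem_Ioc]
    constructor
    · rintro ⟨h1, h2⟩
      have : i ≠ k + 1 := fun h => h2 (h ▸ hrS)
      by_cases h3 : i ≤ k
      · exact Or.inr ⟨h1.1, h3⟩
      · exact Or.inl ⟨⟨by omega, h1.2⟩, h2⟩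
    · rintro (⟨h1, h2⟩ | h1)
      · exact ⟨⟨by omega, h1.2⟩, h2⟩
      · refine ⟨⟨h1.1, by omega⟩, fun h => ?_⟩
        have : k + 1 ≤ i := hr.2 h
        omega
  have hdisj : Disjoint (up.image (Sum.inr : ℕ → Signal)) ((Finset.Icc 1 k).image Sum.inr) := by
    rw [Finset.disjoint_image Sum.inr_injective, Finset.disjoint_left]
    intro i hi hi'
    simp only [hup, Finset.mem_sdiff, Finset.mem_Icc, Finset.mem_Ioc] at hi hi'
    omega
  set G : Path → ℝ≥0∞ := fun w =>
    gaussianPDF 0 ((k + 1 : ℕ) * (q * (1 - q))) (innovation q z (k + 1) w - innovation q z 0 w)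
    with hG
  have hfun : pathDensity q N z = fun w =>
      (stepsDensity 1 (fun i w => marketValue z w i) 0 N w *
        stepsDensity (q * (1 - q)) (innovation q z) (k + 1) N w) *
        stepsDensity (q * (1 - q)) (innovation q z) 0 (k + 1) w := by
    funext w
    rw [pathDensity_eq hq0 hq, mul_assoc, mul_comm (stepsDensity (q * (1 - q)) _ _ N w),
      stepsDensity_mul (by omega) htr.2]
  have hdep1 : DependsOn (fun w => stepsDensity 1 (fun i w => marketValue z w i) 0 N w *
        stepsDensity (q * (1 - q)) (innovation q z) (k + 1) N w)
      {σ : Signal | ∀ j, σ = Sum.inr j → k + 1 ≤ j} := by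
    intro x y hxy
    dsimp only
    rw [dependsOn_stepsDensity (fun i _ _ => dependsOn_marketValue_inl z i (by simp)) hxy,
      dependsOn_stepsDensity (fun i hi _ => dependsOn_innovation q z i (by simp) (by
        intro j hj; rw [Sum.inr.injEq] at hj; omega)) hxy]
  have hdep2 : DependsOn (fun w => stepsDensity 1 (fun i w => marketValue z w i) 0 N w * G w)
      {σ : Signal | ∀ j, σ = Sum.inr j → j = k + 1} := by
    intro x y hxy
    simp only [hG]
    rw [dependsOn_stepsDensity (fun i _ _ => dependsOn_marketValue_inl z i (by simp)) hxy,
      dependsOn_innovation q z (k + 1) (by simp) (by simp [eq_comm]) hxy]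
    simp [innovation, expertValue, marketValue]
  have hdep3 : DependsOn (fun w => G w * D z w)
      {σ : Signal | ∀ j, σ = Sum.inl j → k + 1 ≤ j} := by
    intro x y hxy
    simp only [hG, hD]
    rw [dependsOn_innovation q z (k + 1) (by simp) (by simp) hxy,
      dependsOn_lmarginal (dependsOn_stepsDensity (fun i hi _ => dependsOn_innovation q z i (by
        intro j hj; rw [Sum.inl.injEq] at hj; omega) (by simp))) hxy]
    simp [innovation, expertValue, marketValue]
  have hfull : Measurable (pathDensity q N z) := by
    rw [hfun]; exact ((hX _ _).mul (hUz _ _)).mul (hUz _ _)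
  -- The order matters because an innovation involves both signals of its time: first the expert
  -- signals below `r`, then those above, and last the market signals below `t`, on which the
  -- results no longer depend because `t ≤ r`.
  rw [likelihood, hidden_eq, lmarginal_union _ _ hfull (disjoint_image_inl_inr _ _), hsplit,
    lmarginal_union _ _ hfull hdisj, hfun,
    lmarginal_mul_of_dependsOn hdep1 _ (hUz _ _),
    (isWalk_innovation q z).lmarginal_stepsDensity hv]
  · have h1 : (fun w => (stepsDensity 1 (fun i w => marketValue z w i) 0 N w *
        stepsDensity (q * (1 - q)) (innovation q z) (k + 1) N w) * G w) = fun w =>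
        (stepsDensity 1 (fun i w => marketValue z w i) 0 N w * G w) *
        stepsDensity (q * (1 - q)) (innovation q z) (k + 1) N w := by
      funext w; ring
    rw [show (fun w => (stepsDensity 1 (fun i w => marketValue z w i) 0 N w *
        stepsDensity (q * (1 - q)) (innovation q z) (k + 1) N w) *
        (fun w => gaussianPDF 0 ((k + 1 : ℕ) * (q * (1 - q)))
          (innovation q z (k + 1) w - innovation q z 0 w)) w) = _ from h1,
      lmarginal_mul_of_dependsOn hdep2 _ (hUz _ _)]
    · have h2 : (fun w => (stepsDensity 1 (fun i w => marketValue z w i) 0 N w * G w) *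
          lmarginal (fun _ => (volume : Measure ℝ)) (up.image (Sum.inr : ℕ → Signal))
            (stepsDensity (q * (1 - q)) (innovation q z) (k + 1) N) w) = fun w =>
          (G w * D z w) * stepsDensity 1 (fun i w => marketValue z w i) 0 N w := by
        funext w; simp only [hD]; ring
      rw [h2, lmarginal_mul_of_dependsOn hdep3 _ (hX _ _), lmarginal_marketValue ht htN]
      · simp only [hDz z, hG]
        rw [stepsDensity_marketValue_eq ht N z 0]
        have : innovation q z (k + 1) w - innovation q z 0 w =
            w (Sum.inr (k + 1)) - (1 - q) * w (Sum.inl (k + 1)) - q * z := by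
          simp [innovation, expertValue, marketValue]; ring
        rw [this]
        ring
      · intro i hi h
        obtain ⟨j, hj, rfl⟩ := Finset.mem_image.1 hi
        have := h j rfl
        rw [Finset.mem_Ico] at hj; omega
    · intro i hi h
      obtain ⟨j, hj, rfl⟩ := Finset.mem_image.1 hi
      have := h j rfl
      simp only [hup, Finset.mem_sdiff, Finset.mem_Ioc] at hj; omega
  · intro i hi h
    obtain ⟨j, hj, rfl⟩ := Finset.mem_image.1 hi
    have := h j rfl
    rw [Finset.mem_Icc] at hj; omega

/-! ### The posterior distribution of the outcome -/

/-- The Gaussian density with precision `p` and mean `m`. -/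
noncomputable def normalDensity (p m z : ℝ) : ℝ :=
  √(p / (2 * Real.pi)) * Real.exp (-(p * (z - m) ^ 2 / 2))

theorem normalDensity_pos {p : ℝ} (hp : 0 < p) (m z : ℝ) : 0 < normalDensity p m z := by
  unfold normalDensity; positivity

theorem normalDensity_eq_gaussianPDFReal {p : ℝ} (hp : 0 < p) (m z : ℝ) :
    normalDensity p m z = gaussianPDFReal m (p⁻¹).toNNReal z := by
  rw [normalDensity, gaussianPDFReal, Real.coe_toNNReal _ (by positivity), ← Real.sqrt_inv]
  congr 2
  · field_simp
  · field_simp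

theorem lintegral_normalDensity {p : ℝ} (hp : 0 < p) (m : ℝ) :
    ∫⁻ z, ENNReal.ofReal (normalDensity p m z) = 1 := by
  simp_rw [normalDensity_eq_gaussianPDFReal hp]
  exact lintegral_gaussianPDF_eq_one m (by simpa using hp)

theorem log_normalDensity {p : ℝ} (hp : 0 < p) (m z : ℝ) :
    Real.log (normalDensity p m z) =
      (Real.log p - Real.log (2 * Real.pi)) / 2 - p * (z - m) ^ 2 / 2 := by
  rw [normalDensity, Real.log_mul (by positivity) (by positivity), Real.log_exp,
    Real.log_sqrt (by positivity), Real.log_div hp.ne' (by positivity)]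
  ring

open Classical in
/-- The precision that the last announcement, among those at the times in `S`, adds to the market's
posterior. -/
noncomputable def announcedPrecision (q : ℝ≥0) (S : Finset ℕ) : ℝ :=
  if h : S.Nonempty then q / ((1 - q) * S.min' h) else 0

open Classical in
/-- What the last announcement, among those at the times in `S`, adds to the product of precision
and mean of the market's posterior. -/
noncomputable def announcedShift (q : ℝ≥0) (S : Finset ℕ) (w : Path) : ℝ :=
  if h : S.Nonempty then
    w (Sum.inr (S.min' h)) / ((1 - q) * S.min' h) - w (Sum.inl (S.min' h)) / S.min' h
  else 0

/-- The market's posterior density at time `t` given the precision `a` and the shift `b` due to the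
announcements and the current market signal `x`. -/
noncomputable def marketDensity (t : ℕ) (a b x z : ℝ) : ℝ :=
  normalDensity (1 / t + a) ((x / t + b) / (1 / t + a)) z

/-- Normalization cancels any factor free of `z`; this is why the likelihood is needed only up to an
unspecified constant. -/
theorem toReal_div_lintegral_eq {L : ℝ → ℝ≥0∞} {C : ℝ≥0∞} (hC0 : C ≠ 0) (hC : C ≠ ⊤) {p m : ℝ}
    (hp : 0 < p) (hL : ∀ z, L z = C * ENNReal.ofReal (normalDensity p m z)) (z : ℝ) :
    (L z / ∫⁻ z', L z').toReal = normalDensity p m z := by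
  simp_rw [hL]
  rw [lintegral_const_mul' _ _ hC, lintegral_normalDensity hp, mul_one, mul_comm,
    ENNReal.mul_div_cancel_right hC0 hC, ENNReal.toReal_ofReal (normalDensity_pos hp m z).le]

variable {q : ℝ≥0}

theorem announcedPrecision_nonneg (hq : q < 1) (S : Finset ℕ) : 0 ≤ announcedPrecision q S := by
  have : (q : ℝ) < 1 := by exact_mod_cast hq
  unfold announcedPrecision
  split_ifs with h
  · have : 0 < 1 - (q : ℝ) := by linarith
    positivity
  · exact le_rfl

theorem bayesDensity_eq (hq0 : q ≠ 0) (hq : q < 1) {t N : ℕ} (ht : 1 ≤ t) (htN : t ≤ N)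
    {S : Finset ℕ} (hS : S ⊆ Finset.Icc t N) (w : Path) (z : ℝ) :
    bayesDensity q N t S w z =
      marketDensity t (announcedPrecision q S) (announcedShift q S w) (w (Sum.inl t)) z := by
  have ht' : (0 : ℝ) < t := by exact_mod_cast ht
  have hp : 0 < 1 / (t : ℝ) + announcedPrecision q S :=
    add_pos_of_pos_of_nonneg (by positivity) (announcedPrecision_nonneg hq S)
  rw [bayesDensity, marketDensity]
  rcases S.eq_empty_or_nonempty with rfl | hne
  · obtain ⟨C, hC0, hC, hL⟩ := likelihood_empty hq0 hq ht htN w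
    refine toReal_div_lintegral_eq hC0 hC hp (fun z => ?_) z
    rw [hL, gaussianPDF, normalDensity_eq_gaussianPDFReal hp]
    simp only [announcedPrecision, announcedShift, Finset.not_nonempty_empty, dif_neg,
      not_false_eq_true, add_zero, one_div, inv_inv, Real.toNNReal_natCast]
    congr 2
    rw [gaussianPDFReal, gaussianPDFReal]
    congr 2
    field_simp
    ring
  · have hq1 : (q : ℝ) < 1 := by exact_mod_cast hq
    have hq1' : 0 < 1 - (q : ℝ) := by linarith
    have hq0' : 0 < (q : ℝ) := by positivity
    have hr := S.isLeast_min' hne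
    obtain ⟨C, hC0, hC, hL⟩ := likelihood_of_isLeast hq0 hq ht htN hS hr w
    have hr0 : (0 : ℝ) < S.min' hne := by
      have := Finset.mem_Icc.1 (hS hr.1); exact_mod_cast (by omega : 0 < S.min' hne)
    simp only [announcedPrecision, announcedShift, hne, dif_pos] at hp ⊢
    set r := S.min' hne
    set X := w (Sum.inl t)
    set U := w (Sum.inr r) - (1 - q) * w (Sum.inl r) with hU
    set p : ℝ := 1 / t + q / ((1 - q) * r) with hpdef
    set b : ℝ := w (Sum.inr r) / ((1 - q) * r) - w (Sum.inl r) / r with hb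
    have hbU : b = U / ((1 - q) * r) := by rw [hb, hU]; field_simp
    set v : ℝ := r * (q * (1 - q)) with hv
    -- The normalizing constants together with the `z`-free remainder from completing the square in
    -- `z`.
    set K : ℝ := (√(2 * Real.pi * t))⁻¹ * (√(2 * Real.pi * v))⁻¹ * (√(p / (2 * Real.pi)))⁻¹ *
      Real.exp (-(X ^ 2 / (2 * t)) - U ^ 2 / (2 * v) + (X / t + b) ^ 2 / p / 2) with hK
    have hv0 : 0 < v := by positivity
    have hK0 : 0 < K := by positivity
    refine toReal_div_lintegral_eq (C := C * ENNReal.ofReal K)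
      (mul_ne_zero hC0 (by simpa using hK0)) (ENNReal.mul_ne_top hC (by simp)) hp (fun z => ?_) z
    rw [hL, mul_assoc, gaussianPDF, gaussianPDF,
      ← ENNReal.ofReal_mul (gaussianPDFReal_nonneg _ _ _), ← ENNReal.ofReal_mul hK0.le]
    congr 2
    have hvc : (((r : ℝ≥0) * (q * (1 - q)) : ℝ≥0) : ℝ) = v := by
      rw [hv, NNReal.coe_mul, NNReal.coe_mul, NNReal.coe_sub hq.le]; simp
    rw [gaussianPDFReal, gaussianPDFReal, hvc, NNReal.coe_natCast, normalDensity, hK]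
    have hsq : (√(p / (2 * Real.pi)))⁻¹ * √(p / (2 * Real.pi)) = 1 :=
      inv_mul_cancel₀ (by positivity)
    have hexp : -(X - z - 0) ^ 2 / (2 * t) + -(U - q * z - 0) ^ 2 / (2 * v) =
        (-(X ^ 2 / (2 * t)) - U ^ 2 / (2 * v) + (X / t + b) ^ 2 / p / 2) +
          -(p * (z - (X / t + b) / p) ^ 2 / 2) := by
      have h1 : p * (z - (X / t + b) / p) ^ 2 =
          p * z ^ 2 - 2 * z * (X / t + b) + (X / t + b) ^ 2 / p := by
        field_simp
        ring
      rw [h1, hpdef, hbU, hv]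
      field_simp
      ring
    calc _ = (√(2 * Real.pi * t))⁻¹ * (√(2 * Real.pi * v))⁻¹ *
          (Real.exp (-(X - z - 0) ^ 2 / (2 * t)) * Real.exp (-(U - q * z - 0) ^ 2 / (2 * v))) := by
          ring
      _ = (√(2 * Real.pi * t))⁻¹ * (√(2 * Real.pi * v))⁻¹ *
          ((√(p / (2 * Real.pi)))⁻¹ * √(p / (2 * Real.pi))) *
          (Real.exp (-(X ^ 2 / (2 * t)) - U ^ 2 / (2 * v) + (X / t + b) ^ 2 / p / 2) *
            Real.exp (-(p * (z - (X / t + b) / p) ^ 2 / 2))) := by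
          rw [← Real.exp_add, hexp, Real.exp_add, hsq, mul_one]
      _ = _ := by ring

/-- The closed form, unlike the likelihood, is continuous at `q = 0`, so the limit defining the
posterior there is its value. -/
theorem posteriorDensity_eq (hq : q < 1) {t N : ℕ} (ht : 1 ≤ t) (htN : t ≤ N)
    {S : Finset ℕ} (hS : S ⊆ Finset.Icc t N) (w : Path) (z : ℝ) :
    posteriorDensity q N t S w z =
      marketDensity t (announcedPrecision q S) (announcedShift q S w) (w (Sum.inl t)) z := by
  rw [posteriorDensity]
  split_ifs with h0
  · subst h0
    have ht' : (0 : ℝ) < t := by exact_mod_cast ht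
    have hev : ∀ᶠ r : ℝ≥0 in 𝓝[>] 0, marketDensity t (announcedPrecision r S)
        (announcedShift r S w) (w (Sum.inl t)) z = bayesDensity r N t S w z := by
      filter_upwards [Ioo_mem_nhdsGT (zero_lt_one' ℝ≥0)] with r hr
      exact (bayesDensity_eq hr.1.ne' hr.2 ht htN hS w z).symm
    have ha : ContinuousAt (fun r : ℝ≥0 => announcedPrecision r S) 0 := by
      unfold announcedPrecision
      split_ifs with h
      · have hr0 : ((S.min' h : ℕ) : ℝ) ≠ 0 := by
          have := Finset.mem_Icc.1 (hS (S.min'_mem h)); exact_mod_cast (by omega : S.min' h ≠ 0)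
        have : (1 - ((0 : ℝ≥0) : ℝ)) * (S.min' h : ℕ) ≠ 0 := by simpa using hr0
        fun_prop (disch := assumption)
      · exact continuousAt_const
    have hb : ContinuousAt (fun r : ℝ≥0 => announcedShift r S w) 0 := by
      unfold announcedShift
      split_ifs with h
      · have hr0 : ((S.min' h : ℕ) : ℝ) ≠ 0 := by
          have := Finset.mem_Icc.1 (hS (S.min'_mem h)); exact_mod_cast (by omega : S.min' h ≠ 0)
        have : (1 - ((0 : ℝ≥0) : ℝ)) * (S.min' h : ℕ) ≠ 0 := by simpa using hr0
        fun_prop (disch := assumption)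
      · exact continuousAt_const
    have hp : 1 / (t : ℝ) + announcedPrecision 0 S ≠ 0 :=
      (add_pos_of_pos_of_nonneg (by positivity) (announcedPrecision_nonneg hq S)).ne'
    have hcont : ContinuousAt (fun r : ℝ≥0 => marketDensity t (announcedPrecision r S)
        (announcedShift r S w) (w (Sum.inl t)) z) 0 := by
      unfold marketDensity normalDensity
      fun_prop (disch := assumption)
    exact ((hcont.tendsto.mono_left nhdsWithin_le_nhds).congr' hev).limUnder_eq
  · exact bayesDensity_eq h0 hq ht htN hS w z

/-! ### The total reward as a sum of scores -/

/-- The times from `t` on (`t ≤ s ≤ N`) at which an announcement was made. -/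
def heard (N : ℕ) (a : ℕ → Option ℝ) (t : ℕ) : Finset ℕ :=
  (Finset.Icc t N).filter fun s => (a s).isSome

/-- The logarithm of the market's density at the outcome, at time `t`; it is set to `0` at
time `0`. -/
noncomputable def logScore (q : ℝ≥0) (t : ℕ) (S : Finset ℕ) (w : Path) : ℝ :=
  if t = 0 then 0 else
    Real.log (marketDensity t (announcedPrecision q S) (announcedShift q S w) (w (Sum.inl t))
      (w (Sum.inl 0)))

/-- The last element of `K` up to `m` (as time flows backwards: the first period of `K` that is
reached from `m`), or `0`. -/
def nextPeriod (K : Finset ℕ) (m : ℕ) : ℕ := (K.filter fun t => t ≤ m).sup id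

theorem nextPeriod_le (K : Finset ℕ) (m : ℕ) : nextPeriod K m ≤ m :=
  Finset.sup_le fun _ ht => (Finset.mem_filter.1 ht).2

theorem nextPeriod_succ_of_mem {K : Finset ℕ} {m : ℕ} (h : m + 1 ∈ K) :
    nextPeriod K (m + 1) = m + 1 :=
  le_antisymm (nextPeriod_le K _) (Finset.le_sup (f := id) (Finset.mem_filter.2 ⟨h, le_rfl⟩))

theorem filter_le_succ_of_notMem {K : Finset ℕ} {m : ℕ} (h : m + 1 ∉ K) :
    (K.filter fun t => t ≤ m + 1) = K.filter fun t => t ≤ m := by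
  ext t
  simp only [Finset.mem_filter, and_congr_right_iff]
  intro ht
  have : t ≠ m + 1 := fun h' => h (h' ▸ ht)
  omega

theorem nextPeriod_succ_of_notMem {K : Finset ℕ} {m : ℕ} (h : m + 1 ∉ K) :
    nextPeriod K (m + 1) = nextPeriod K m := by
  rw [nextPeriod, filter_le_succ_of_notMem h, nextPeriod]

theorem heard_of_isNone {N : ℕ} {a : ℕ → Option ℝ} {t : ℕ} (h : a t = none) :
    heard N a t = heard N a (t + 1) := by
  ext s
  simp only [heard, Finset.mem_filter, Finset.mem_Icc]
  constructor
  · rintro ⟨h1, h2⟩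
    have : s ≠ t := by rintro rfl; simp [h] at h2
    exact ⟨by omega, h2⟩
  · rintro ⟨h1, h2⟩
    exact ⟨by omega, h2⟩

theorem heard_subset (N : ℕ) (a : ℕ → Option ℝ) (t : ℕ) : heard N a t ⊆ Finset.Icc t N :=
  Finset.filter_subset _ _

variable {q : ℝ≥0}

theorem marketDensity_pos (hq : q < 1) {t : ℕ} (ht : 1 ≤ t) (S : Finset ℕ) (b x z : ℝ) :
    0 < marketDensity t (announcedPrecision q S) b x z := by
  have ht' : (0 : ℝ) < t := by exact_mod_cast ht
  exact normalDensity_pos (add_pos_of_pos_of_nonneg (by positivity)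
    (announcedPrecision_nonneg hq S)) _ _

/-- Silence needs no separate treatment: it leaves the heard set unchanged, so the two scores
cancel. -/
theorem periodReward_eq (hq : q < 1) {t N : ℕ} (ht : 1 ≤ t) (htN : t ≤ N) (a : ℕ → Option ℝ)
    (w : Path) : periodReward q N a w t =
      logScore q t (heard N a t) (perceived w a) -
        logScore q t (heard N a (t + 1)) (perceived w a) := by
  rw [periodReward]
  split_ifs with h
  · have hA : densityAfter q N a w t = posteriorDensity q N t (heard N a t) (perceived w a) := rfl
    have hB : densityBefore q N a w t =
        posteriorDensity q N t (heard N a (t + 1)) (perceived w a) := by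
      have : (Finset.Ioc t N).filter (fun s => (a s).isSome) = heard N a (t + 1) := by
        ext s; simp [heard]
      rw [densityBefore, this]
    have h1 := posteriorDensity_eq hq ht htN (heard_subset N a t) (perceived w a)
    have h2 := posteriorDensity_eq hq ht htN ((heard_subset N a (t + 1)).trans
      (Finset.Icc_subset_Icc_left (by omega))) (perceived w a)
    have ht0 : t ≠ 0 := by omega
    rw [hA, hB, h1, h2, Real.log_div (marketDensity_pos hq ht _ _ _ _).ne'
      (marketDensity_pos hq ht _ _ _ _).ne']
    simp [logScore, ht0, perceived]
  · rw [heard_of_isNone (by simpa using h), sub_self]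

/-- Abel summation. No announcement is made between consecutive allowed periods, so the record held
after `t` is still the one held just before the next allowed period. The score at time 0, where
nothing more is earned, is 0 by convention and closes the sum. -/
theorem sum_periodReward_eq (hq : q < 1) {N : ℕ} {K : Finset ℕ} (hK : K ⊆ Finset.Icc 1 N)
    (a : ℕ → Option ℝ) (w : Path) {n : ℕ} (ha : ∀ t ≤ n, t ∉ K → a t = none) :
    ∑ t ∈ K.filter (fun t => t ≤ n), periodReward q N a w t =
      -logScore q (nextPeriod K n) (heard N a (n + 1)) (perceived w a) +
      ∑ t ∈ K.filter (fun t => t ≤ n),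
        (logScore q t (heard N a t) (perceived w a) -
          logScore q (nextPeriod K (t - 1)) (heard N a t) (perceived w a)) := by
  induction n with
  | zero =>
    have h0 : (K.filter fun t => t ≤ 0) = ∅ := by
      refine Finset.filter_eq_empty_iff.2 fun t ht => ?_
      have := Finset.mem_Icc.1 (hK ht); omega
    have : nextPeriod K 0 = 0 := Nat.le_zero.1 (nextPeriod_le K 0)
    rw [h0, this]
    simp [logScore]
  | succ m ih =>
    have ih := ih fun t ht => ha t (by omega)
    by_cases hm : m + 1 ∈ K
    · have hins : (K.filter fun t => t ≤ m + 1) = insert (m + 1) (K.filter fun t => t ≤ m) := by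
        ext t
        simp only [Finset.mem_filter, Finset.mem_insert]
        constructor
        · rintro ⟨h1, h2⟩
          by_cases h3 : t = m + 1
          · exact Or.inl h3
          · exact Or.inr ⟨h1, by omega⟩
        · rintro (rfl | ⟨h1, h2⟩)
          · exact ⟨hm, le_rfl⟩
          · exact ⟨h1, by omega⟩
      have hnot : m + 1 ∉ K.filter fun t => t ≤ m := by simp
      have hN := Finset.mem_Icc.1 (hK hm)
      rw [hins, Finset.sum_insert hnot, Finset.sum_insert hnot, ih,
        periodReward_eq hq hN.1 hN.2, nextPeriod_succ_of_mem hm, Nat.add_sub_cancel]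
      ring
    · rw [filter_le_succ_of_notMem hm, nextPeriod_succ_of_notMem hm,
        ← heard_of_isNone (ha _ le_rfl hm), ih]

/-! ### The market's forecast of its own signals -/

/-- The precision of the market's forecast, at time `t`, of the signal at time `s < t`, if the
announcements add the precision `a`. -/
noncomputable def forecastPrecision (t s a : ℝ) : ℝ := (1 + t * a) / ((t - s) * (1 + s * a))

/-- The mean of the market's forecast, at time `t`, of the signal at time `s < t`, if the
announcements add the precision `a` and the shift `b`, and the current market signal is `x`. -/
noncomputable def forecastMean (t s a b x : ℝ) : ℝ :=
  s / t * x + (1 - s / t) * ((x + t * b) / (1 + t * a))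

theorem forecastPrecision_pos {t s a : ℝ} (hs : 0 ≤ s) (hst : s < t) (ha : 0 ≤ a) :
    0 < forecastPrecision t s a := by
  have : 0 < t - s := by linarith
  have : 0 ≤ t := by linarith
  unfold forecastPrecision
  positivity

theorem forecastPrecision_le {t s a : ℝ} (hs : 0 ≤ s) (hst : s < t) (ha : 0 ≤ a) :
    forecastPrecision t s a ≤ (1 + t * a) / (t - s) := by
  have h1 : 0 < t - s := by linarith
  have h2 : 0 ≤ t := by linarith
  unfold forecastPrecision
  have : t - s ≤ (t - s) * (1 + s * a) :=
    le_mul_of_one_le_right h1.le (by nlinarith [mul_nonneg hs ha])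
  exact div_le_div_of_nonneg_left (by positivity) h1 this

/-- The part of the change of the market's score from time `t` to time `s < t` that does not depend
on the announcements. -/
noncomputable def commonScore (t s : ℕ) (x y z : ℝ) : ℝ :=
  if s = 0 then -(Real.log (2 * Real.pi) / 2) else
    Real.log (s * (t - s) / t : ℝ) / 2 +
      t / (s * (t - s)) * (y - (s / t * x + (1 - s / t) * z)) ^ 2 / 2

/-- Bayes' rule: f_s(z) is f_t(z) times the density of X_s given X_t and X_0 = z, divided by the
market's forecast density of X_s at time t. The former is that of a bridge from `z` to X_t and
ignores the announcements; it makes up `commonScore`. For `s = 0` the forecast is that of the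
outcome itself. -/
theorem logScore_sub_logScore (hq : q < 1) {t s : ℕ} (hst : s < t) (S : Finset ℕ) (w : Path) :
    logScore q t S w - logScore q s S w =
      Real.log (forecastPrecision t s (announcedPrecision q S)) / 2 -
        forecastPrecision t s (announcedPrecision q S) * (w (Sum.inl s) -
          forecastMean t s (announcedPrecision q S) (announcedShift q S w) (w (Sum.inl t))) ^ 2 / 2
        + commonScore t s (w (Sum.inl t)) (w (Sum.inl s)) (w (Sum.inl 0)) := by
  have ht0 : t ≠ 0 := by omega
  have ht : (0 : ℝ) < t := by positivity
  have ha := announcedPrecision_nonneg hq S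
  set a := announcedPrecision q S
  set b := announcedShift q S w
  set x := w (Sum.inl t)
  set z := w (Sum.inl 0)
  have hpt : 0 < 1 / (t : ℝ) + a := by positivity
  have h1 : 0 < 1 + t * a := by positivity
  rcases Nat.eq_zero_or_pos s with rfl | hs
  · have hP : forecastPrecision t (0 : ℕ) a = 1 / t + a := by
      unfold forecastPrecision; push_cast; field_simp; simp [ht0]
    have hM : forecastMean t (0 : ℕ) a b x = (x / t + b) / (1 / t + a) := by
      unfold forecastMean; push_cast; field_simp; ring
    rw [hP, hM]
    simp only [logScore, ht0, if_true, if_false, commonScore, marketDensity]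
    rw [log_normalDensity hpt]
    ring
  · have hs0 : s ≠ 0 := by omega
    have hs' : (0 : ℝ) < s := by exact_mod_cast hs
    have hts : (0 : ℝ) < t - s := by have : (s : ℝ) < t := by exact_mod_cast hst
                                     linarith
    have hps : 0 < 1 / (s : ℝ) + a := by positivity
    have h2 : 0 < 1 + s * a := by positivity
    set y := w (Sum.inl s)
    have hlog : Real.log (1 / t + a) - Real.log (1 / s + a) =
        Real.log (forecastPrecision t s a) + Real.log (s * (t - s) / t : ℝ) := by
      have hc : (0 : ℝ) < s * (t - s) / t := by positivity
      rw [← Real.log_div hpt.ne' hps.ne', ← Real.log_mul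
        (forecastPrecision_pos hs'.le (by linarith) ha).ne' hc.ne']
      congr 1
      unfold forecastPrecision
      field_simp
    have hquad : -((1 / t + a) * (z - (x / t + b) / (1 / t + a)) ^ 2 / 2) +
        (1 / s + a) * (z - (y / s + b) / (1 / s + a)) ^ 2 / 2 =
        -(forecastPrecision t s a * (y - forecastMean t s a b x) ^ 2 / 2) +
          t / (s * (t - s)) * (y - (s / t * x + (1 - s / t) * z)) ^ 2 / 2 := by
      unfold forecastPrecision forecastMean
      field_simp
      ring
    simp only [logScore, ht0, hs0, if_false, commonScore, marketDensity]
    rw [log_normalDensity hpt, log_normalDensity hps]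
    linarith

/-- The conditional variance of `X_s` given the expert's information at time `t > s`. -/
noncomputable def expertVariance (q : ℝ≥0) (t s : ℕ) : ℝ := (t - s) * (t * (1 - q) + q * s) / t

theorem expertVariance_pos (hq : q < 1) {t s : ℕ} (hst : s < t) : 0 < expertVariance q t s := by
  have hq1 : (q : ℝ) < 1 := by exact_mod_cast hq
  have hq' : (0 : ℝ) < 1 - q := by linarith
  have h1 : (s : ℝ) < t := by exact_mod_cast hst
  have h2 : (0 : ℝ) < t - s := by linarith
  have h3 : (0 : ℝ) < t := lt_of_le_of_lt s.cast_nonneg h1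
  unfold expertVariance
  positivity

/-- The error of the expert's forecast, at time `t`, of `X_s`. -/
noncomputable def expertError (t s : ℕ) (w : Path) : ℝ :=
  w (Sum.inl s) - (s / t * w (Sum.inl t) + (1 - s / t) * w (Sum.inr t))

theorem announced_of_isLeast (q : ℝ≥0) {S : Finset ℕ} {t : ℕ} (h : IsLeast (S : Set ℕ) t)
    (w : Path) : announcedPrecision q S = q / ((1 - q) * t) ∧
      announcedShift q S w = w (Sum.inr t) / ((1 - q) * t) - w (Sum.inl t) / t := by
  have hne : S.Nonempty := ⟨t, h.1⟩
  have : S.min' hne = t := (S.isLeast_min' hne).unique h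
  simp [announcedPrecision, announcedShift, hne, this]

/-- If the latest announcement is at `t`, then taking it at face value gives the market the mean and
variance that the expert would have with that value as Y_t. Earlier announcements have dropped out.
-/
theorem forecast_of_isLeast (hq : q < 1) {S : Finset ℕ} {t s : ℕ} (hst : s < t)
    (h : IsLeast (S : Set ℕ) t) (w : Path) :
    forecastPrecision t s (announcedPrecision q S) = (expertVariance q t s)⁻¹ ∧
    w (Sum.inl s) -
      forecastMean t s (announcedPrecision q S) (announcedShift q S w) (w (Sum.inl t)) =
      expertError t s w := by
  obtain ⟨h1, h2⟩ := announced_of_isLeast q h w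
  have hq1 : (q : ℝ) < 1 := by exact_mod_cast hq
  have hq' : (0 : ℝ) < 1 - q := by linarith
  have hst' : (s : ℝ) < t := by exact_mod_cast hst
  have hts : (0 : ℝ) < t - s := by linarith
  have ht : (0 : ℝ) < t := lt_of_le_of_lt (by positivity) hst'
  have hpos : (0 : ℝ) < t * (1 - q) + q * s := by positivity
  have h3 : 1 + (t : ℝ) * (q / ((1 - q) * t)) = 1 / (1 - q) := by field_simp; ring
  have h4 : 1 + (s : ℝ) * (q / ((1 - q) * t)) = (t * (1 - q) + q * s) / ((1 - q) * t) := by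
    field_simp
  rw [h1, h2]
  constructor
  · rw [forecastPrecision, expertVariance, h3, h4]
    field_simp
  · rw [forecastMean, expertError, h3]
    field_simp
    ring

/-! ### Linear combinations of independent Gaussian variables -/

section LinearCombination

variable {Ω ι : Type*} [MeasurableSpace Ω] {P : Measure Ω}

/-- The bilinear form with `v` on the diagonal. -/
noncomputable def diagForm (v : ι → ℝ) : (ι →₀ ℝ) →ₗ[ℝ] (ι →₀ ℝ) →ₗ[ℝ] ℝ :=
  Finsupp.linearCombination ℝ fun i => v i • Finsupp.lapply i

theorem diagForm_apply (v : ι → ℝ) (c d : ι →₀ ℝ) :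
    diagForm v c d = ∑ i ∈ c.support, c i * (v i * d i) := by
  simp [diagForm, Finsupp.linearCombination_apply, Finsupp.sum]

variable {W : ι → Ω → ℝ} {v : ι → ℝ≥0}

theorem hasGaussianLaw_of_map_eq {X : Ω → ℝ} {μ : ℝ} {σ : ℝ≥0}
    (h : P.map X = gaussianReal μ σ) : HasGaussianLaw X P := by
  constructor
  rw [h]
  infer_instance

theorem isGaussianProcess_of_iIndepFun (hG : ∀ i, HasGaussianLaw (W i) P) (hW : iIndepFun W P) :
    IsGaussianProcess W P where
  hasGaussianLaw I := by
    have h := hW.precomp (g := fun i : I => (i : ι)) Subtype.val_injective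
    exact h.hasGaussianLaw fun i => hG i

theorem isGaussianProcess_linearCombination {κ : Type*} (hW : IsGaussianProcess W P)
    (c : κ → ι →₀ ℝ) :
    IsGaussianProcess (fun k ω => Finsupp.linearCombination ℝ (W · ω) (c k)) P := by
  refine hW.of_isGaussianProcess fun k => ⟨(c k).support,
    ∑ i : (c k).support, (c k i) • ContinuousLinearMap.proj i, fun ω => ?_⟩
  rw [Finsupp.linearCombination_apply, Finsupp.sum, ← Finset.sum_coe_sort]
  simp

theorem memLp_linearCombination (hG : ∀ i, HasGaussianLaw (W i) P) (c : ι →₀ ℝ) :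
    MemLp (fun ω => Finsupp.linearCombination ℝ (W · ω) c) 2 P := by
  simp only [Finsupp.linearCombination_apply, Finsupp.sum, smul_eq_mul]
  exact memLp_finsetSum _ fun i _ => (hG i).memLp_two.const_mul _

theorem integral_linearCombination [IsProbabilityMeasure P] (hW : ∀ i, Measurable (W i))
    (hlaw : ∀ i, P.map (W i) = gaussianReal 0 (v i)) (c : ι →₀ ℝ) :
    ∫ ω, Finsupp.linearCombination ℝ (W · ω) c ∂P = 0 := by
  have hG := fun i => hasGaussianLaw_of_map_eq (hlaw i)
  simp only [Finsupp.linearCombination_apply, Finsupp.sum, smul_eq_mul]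
  rw [integral_finsetSum _ fun i _ => ((hG i).memLp_two.integrable one_le_two).const_mul _]
  refine Finset.sum_eq_zero fun i _ => ?_
  have h0 : ∫ ω, W i ω ∂P = 0 := by
    have := integral_map (μ := P) (hW i).aemeasurable
      (f := fun x : ℝ => x) (by fun_prop)
    rw [← this, hlaw, integral_id_gaussianReal]
  rw [integral_const_mul, h0, mul_zero]

theorem covariance_linearCombination [IsProbabilityMeasure P] (hW : ∀ i, Measurable (W i))
    (hlaw : ∀ i, P.map (W i) = gaussianReal 0 (v i)) (hind : iIndepFun W P) (c d : ι →₀ ℝ) :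
    cov[fun ω => Finsupp.linearCombination ℝ (W · ω) c,
      fun ω => Finsupp.linearCombination ℝ (W · ω) d; P] = diagForm (fun i => (v i : ℝ)) c d := by
  classical
  have hG := fun i => hasGaussianLaw_of_map_eq (hlaw i)
  have h2 : ∀ i, MemLp (W i) 2 P := fun i => (hG i).memLp_two
  have hcov : ∀ i j, cov[W i, W j; P] = if i = j then (v i : ℝ) else 0 := by
    intro i j
    split_ifs with h
    · subst h
      rw [covariance_self (hW i).aemeasurable]
      have := variance_map (μ := P) (X := id) (Y := W i) (by fun_prop) (hW i).aemeasurable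
      rw [hlaw, variance_id_gaussianReal] at this
      exact this.symm
    · exact (hind.indepFun h).covariance_eq_zero (h2 i) (h2 j)
  simp only [Finsupp.linearCombination_apply, Finsupp.sum, smul_eq_mul]
  rw [covariance_fun_sum_fun_sum' (fun i _ => (h2 i).const_mul _) (fun i _ => (h2 i).const_mul _),
    diagForm_apply]
  refine Finset.sum_congr rfl fun i _ => ?_
  simp only [covariance_const_mul_left, covariance_const_mul_right, hcov]
  simp only [mul_ite, mul_zero, Finset.sum_ite_eq]
  split_ifs with h
  · ring
  · rw [Finsupp.notMem_support_iff.1 h]; ring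

/-- Jointly Gaussian families with vanishing cross-covariances are independent. -/
theorem indepFun_linearCombination [IsProbabilityMeasure P] {κ κ' : Type*}
    (hW : ∀ i, Measurable (W i))
    (hlaw : ∀ i, P.map (W i) = gaussianReal 0 (v i)) (hind : iIndepFun W P)
    (c : κ → ι →₀ ℝ) (d : κ' → ι →₀ ℝ)
    (h : ∀ k l, diagForm (fun i => (v i : ℝ)) (c k) (d l) = 0) :
    IndepFun (fun ω k => Finsupp.linearCombination ℝ (W · ω) (c k))
      (fun ω l => Finsupp.linearCombination ℝ (W · ω) (d l)) P := by
  have hG := fun i => hasGaussianLaw_of_map_eq (hlaw i)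
  have hp := isGaussianProcess_linearCombination (isGaussianProcess_of_iIndepFun hG hind)
    (Sum.elim c d)
  refine IsGaussianProcess.indepFun_of_covariance_eq_zero
    (X := fun k ω => Finsupp.linearCombination ℝ (W · ω) (c k))
    (Y := fun l ω => Finsupp.linearCombination ℝ (W · ω) (d l)) ?_
    (fun k => (memLp_linearCombination hG _).aestronglyMeasurable.aemeasurable)
    (fun k => (memLp_linearCombination hG _).aestronglyMeasurable.aemeasurable) fun k l => ?_
  · convert hp using 1
    funext k
    rcases k with k | k <;> rfl
  · rw [covariance_linearCombination hW hlaw hind, h]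

end LinearCombination

/-! ### Conditional distribution given an independent component -/

/-- By independence the joint law of `H` and `f (H, R)` disintegrates along the kernel that freezes
`H` at `h`; disintegrations are almost everywhere unique. -/
theorem condDistrib_ae_eq_map_of_indepFun {Ω α β γ : Type*} [MeasurableSpace Ω]
    [MeasurableSpace α] [MeasurableSpace β] [MeasurableSpace γ] [StandardBorelSpace γ] [Nonempty γ]
    {P : Measure Ω} [IsProbabilityMeasure P] {H : Ω → α} {R : Ω → β} (hH : Measurable H)
    (hR : Measurable R) (hind : IndepFun H R P) {f : α × β → γ} (hf : Measurable f) :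
    ∀ᵐ h ∂(P.map H), condDistrib (fun ω => f (H ω, R ω)) H P h = P.map fun ω => f (h, R ω) := by
  have : IsProbabilityMeasure (P.map R) := Measure.isProbabilityMeasure_map hR.aemeasurable
  have : IsProbabilityMeasure (P.map H) := Measure.isProbabilityMeasure_map hH.aemeasurable
  let κ : Kernel α γ := ((Kernel.id ×ₖ Kernel.const α (P.map R)).map f)
  have hκ : ∀ h, κ h = P.map fun ω => f (h, R ω) := by
    intro h
    simp only [κ]
    rw [Kernel.map_apply _ hf, Kernel.prod_apply, Kernel.id_apply, Kernel.const_apply,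
      Measure.dirac_prod, Measure.map_map hf (by fun_prop), Measure.map_map (by fun_prop) hR]
    rfl
  have heq : condDistrib (fun ω => f (H ω, R ω)) H P =ᵐ[P.map H] κ := by
    refine condDistrib_ae_eq_of_measure_eq_compProd_of_measurable hH (by fun_prop) ?_
    have h1 : (fun ω => (H ω, f (H ω, R ω))) = (fun p : α × β => (p.1, f p)) ∘
        fun ω => (H ω, R ω) := rfl
    rw [h1, ← Measure.map_map (by fun_prop) (by fun_prop),
      hind.map_prod_eq_prod_map_map hH.aemeasurable hR.aemeasurable]
    ext s hs
    rw [Measure.map_apply (by fun_prop) hs, Measure.compProd_apply hs,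
      Measure.prod_apply (by measurability)]
    refine lintegral_congr fun h => ?_
    rw [hκ, Measure.map_apply (by fun_prop) (measurable_prodMk_left hs),
      Measure.map_apply hR (by measurability)]
    rfl
  filter_upwards [heq] with h hh
  rw [hh, hκ]

/-! ### The expert's forecast of all signals -/

section Forecast

variable {M : Type*} [AddCommGroup M] [Module ℝ M]

/-- The forecast of all signals given those at the times from `n` to `N`. -/
noncomputable def forecast (N n : ℕ) (w : Signal → M) : Signal → M
  | Sum.inl t => if t < n then w (Sum.inr n) + (t / n : ℝ) • (w (Sum.inl n) - w (Sum.inr n))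
      else if t ≤ N then w (Sum.inl t) else w (Sum.inl N)
  | Sum.inr t => if t < n then w (Sum.inr n)
      else if t ≤ N then w (Sum.inr t) else w (Sum.inr N)

/-- The weights of the forecast sum to one, so it commutes with affine maps. Forecasting is defined
over any module so that the error can be computed on coefficient vectors and then transported to
real paths. -/
theorem sub_forecast_comp_affine {M' : Type*} [AddCommGroup M'] [Module ℝ M']
    (N n : ℕ) (f : M →ₗ[ℝ] M')
    (x : M') (w : Signal → M) (σ : Signal) :
    (x + f (w σ)) - forecast N n (fun σ => x + f (w σ)) σ = f (w σ - forecast N n w σ) := by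
  rcases σ with t | t
  · simp only [forecast]
    split_ifs
    · simp only [map_sub, map_add, map_smul]
      module
    all_goals simp
  · simp only [forecast]
    split_ifs <;> simp

end Forecast

/-- The path of signals that a history records. -/
def recorded (h : History) : Path := Sum.elim (fun t => (h t).1) (fun t => (h t).2)

theorem measurable_recorded : Measurable recorded := by
  refine measurable_pi_iff.2 fun σ => ?_
  rcases σ with t | t
  · exact (measurable_pi_apply t).fst
  · exact (measurable_pi_apply t).snd

theorem recorded_history {N n : ℕ} (w : Path) {t : ℕ} (h1 : n ≤ t) (h2 : t ≤ N) :
    recorded (history N n w) (Sum.inl t) = w (Sum.inl t) ∧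
      recorded (history N n w) (Sum.inr t) = w (Sum.inr t) := by
  simp [recorded, history, h1, h2]

theorem forecast_recorded_history {N n m : ℕ} (hn : n ≤ N) (hm : m ≤ n) (w : Path) :
    forecast N n (recorded (history N m w)) = forecast N n w := by
  funext σ
  rcases σ with t | t
  · simp only [forecast]
    split_ifs with h1 h2
    · rw [(recorded_history w hm hn).1, (recorded_history w hm hn).2]
    · rw [(recorded_history w (by omega) h2).1]
    · rw [(recorded_history w (by omega) le_rfl).1]
  · simp only [forecast]
    split_ifs with h1 h2
    · rw [(recorded_history w hm hn).2]
    · rw [(recorded_history w (by omega) h2).2]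
    · rw [(recorded_history w (by omega) le_rfl).2]

theorem measurable_forecast (N n : ℕ) : Measurable (forecast N n : Path → Path) := by
  refine measurable_pi_iff.2 fun σ => ?_
  rcases σ with t | t
  · simp only [forecast]
    split_ifs <;> fun_prop
  · simp only [forecast]
    split_ifs <;> fun_prop

theorem measurable_history (N n : ℕ) : Measurable (history N n) := by
  refine measurable_pi_iff.2 fun t => ?_
  simp only [history]
  split_ifs <;> fun_prop

/-- Tower property: forecasting at `t` from the signals forecast at `n` reproduces the forecast made
at `n`. -/
theorem expertError_forecast {N n t s : ℕ} (hnN : n ≤ N) (hst : s < t) (htn : t ≤ n) (w : Path) :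
    expertError t s (forecast N n w) = 0 := by
  have ht : (t : ℝ) ≠ 0 := by exact_mod_cast (by omega : t ≠ 0)
  have hn : (n : ℝ) ≠ 0 := by exact_mod_cast (by omega : n ≠ 0)
  have hs : s < n := by omega
  rcases htn.lt_or_eq with h | rfl
  · simp only [expertError, forecast, hs, h, if_true, smul_eq_mul]
    field_simp
    ring
  · simp only [expertError, forecast, hs, hnN, if_true, if_false, lt_irrefl, smul_eq_mul]
    ring

/-! ### The expert's belief -/

/-- The coefficients of `A_1 + … + A_t`. -/
noncomputable def sumA (t : ℕ) : Signal →₀ ℝ := ∑ i ∈ Finset.Icc 1 t, Finsupp.single (Sum.inl i) 1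

/-- The coefficients of `B_1 + … + B_t`. -/
noncomputable def sumB (t : ℕ) : Signal →₀ ℝ := ∑ i ∈ Finset.Icc 1 t, Finsupp.single (Sum.inr i) 1

/-- The coefficients of the signals, relative to the initial price, in terms of the steps. -/
noncomputable def signalCoeff (N : ℕ) : Signal → Signal →₀ ℝ
  | Sum.inl t => sumA t + sumB t - sumA N - sumB N
  | Sum.inr t => sumB t - sumA N - sumB N

/-- The variances of the steps. -/
def stepVariance (q : ℝ≥0) : Signal → ℝ≥0 := Sum.elim (fun _ => q) (fun _ => 1 - q)

/-! ### Orthogonality of forecast errors and observed signals -/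

section Form

set_option linter.unusedSimpArgs false

variable (q : ℝ≥0)

/-- The covariance form of the steps. -/
noncomputable abbrev stepForm : (Signal →₀ ℝ) →ₗ[ℝ] (Signal →₀ ℝ) →ₗ[ℝ] ℝ :=
  diagForm fun i => (stepVariance q i : ℝ)

theorem stepForm_single (i j : Signal) :
    stepForm q (Finsupp.single i 1) (Finsupp.single j 1) =
      if i = j then (stepVariance q i : ℝ) else 0 := by
  classical
  simp [stepForm, diagForm, Finsupp.single_apply, eq_comm]

theorem sum_Icc_ite (s t : ℕ) (v : ℝ) :
    ∑ i ∈ Finset.Icc 1 s, ∑ j ∈ Finset.Icc 1 t, (if i = j then v else 0) = v * min s t := by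
  have : (Finset.Icc 1 s).filter (· ∈ Finset.Icc 1 t) = Finset.Icc 1 (min s t) := by
    ext i; simp only [Finset.mem_filter, Finset.mem_Icc]; omega
  simp only [Finset.sum_ite_eq]
  rw [← Finset.sum_filter, this, Finset.sum_const, Nat.card_Icc, nsmul_eq_mul, mul_comm]
  simp

theorem stepForm_sumA_sumA (s t : ℕ) : stepForm q (sumA s) (sumA t) = q * min s t := by
  simp only [sumA, map_sum, LinearMap.sum_apply, stepForm_single, Sum.inl.injEq]
  rw [Finset.sum_comm]
  exact sum_Icc_ite s t q

theorem stepForm_sumB_sumB (hq : q < 1) (s t : ℕ) :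
    stepForm q (sumB s) (sumB t) = (1 - q) * min s t := by
  simp only [sumB, map_sum, LinearMap.sum_apply, stepForm_single, Sum.inr.injEq]
  rw [Finset.sum_comm, ← NNReal.coe_one, ← NNReal.coe_sub hq.le]
  exact sum_Icc_ite s t (1 - q : ℝ≥0)

theorem stepForm_sumA_sumB (s t : ℕ) : stepForm q (sumA s) (sumB t) = 0 := by
  simp [stepForm, diagForm, sumA, sumB, map_sum, LinearMap.sum_apply]

theorem stepForm_sumB_sumA (s t : ℕ) : stepForm q (sumB s) (sumA t) = 0 := by
  simp [stepForm, diagForm, sumA, sumB, map_sum, LinearMap.sum_apply]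

/-- The coefficients of the error of the forecast of the signals. -/
noncomputable def errorCoeff (N n : ℕ) (σ : Signal) : Signal →₀ ℝ :=
  signalCoeff N σ - forecast N n (signalCoeff N) σ

variable {q}

/-- Below `n`, the error consists of B-steps not yet revealed and of a bridge of the A-steps pinned
by A_1 + … + A_n, which is X_n - Y_n; from `n` to `N` it is zero; beyond `N` it consists of steps
that enter no observed signal. -/
theorem stepForm_errorCoeff_signalCoeff (hq : q < 1) {N n r : ℕ} (hnr : n ≤ r) (hrN : r ≤ N)
    (σ : Signal) : stepForm q (errorCoeff N n σ) (signalCoeff N (Sum.inl r)) = 0 ∧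
      stepForm q (errorCoeff N n σ) (signalCoeff N (Sum.inr r)) = 0 := by
  rcases σ with t | t <;> simp only [errorCoeff, signalCoeff, forecast]
  · split_ifs with h1 h2
    · have hn0 : (n : ℝ) ≠ 0 := by exact_mod_cast (by omega : n ≠ 0)
      simp only [map_add, map_sub, map_smul, LinearMap.add_apply, LinearMap.sub_apply,
        LinearMap.smul_apply, stepForm_sumA_sumA, stepForm_sumB_sumB q hq, stepForm_sumA_sumB,
        stepForm_sumB_sumA, smul_eq_mul, min_eq_left hnr, min_eq_left hrN,
        min_eq_left (hnr.trans hrN), min_eq_left (h1.le.trans hnr), min_eq_right hrN,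
        min_eq_left (h1.le.trans (hnr.trans hrN)), min_self]
      constructor <;> (field_simp; ring)
    · simp
    · simp only [map_add, map_sub, map_smul, LinearMap.add_apply, LinearMap.sub_apply,
        LinearMap.smul_apply, stepForm_sumA_sumA, stepForm_sumB_sumB q hq, stepForm_sumA_sumB,
        stepForm_sumB_sumA, smul_eq_mul, min_eq_right hrN, min_self,
        min_eq_right (by omega : r ≤ t), min_eq_right (by omega : N ≤ t)]
      constructor <;> ring
  · split_ifs with h1 h2
    · simp only [map_add, map_sub, map_smul, LinearMap.add_apply, LinearMap.sub_apply,
        LinearMap.smul_apply, stepForm_sumA_sumA, stepForm_sumB_sumB q hq, stepForm_sumA_sumB,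
        stepForm_sumB_sumA, smul_eq_mul, min_eq_left hnr, min_eq_left hrN,
        min_eq_left (hnr.trans hrN), min_eq_left (h1.le.trans hnr), min_eq_right hrN,
        min_eq_left (h1.le.trans (hnr.trans hrN)), min_self]
      constructor <;> ring
    · simp
    · simp only [map_add, map_sub, map_smul, LinearMap.add_apply, LinearMap.sub_apply,
        LinearMap.smul_apply, stepForm_sumA_sumA, stepForm_sumB_sumB q hq, stepForm_sumA_sumB,
        stepForm_sumB_sumA, smul_eq_mul, min_eq_right hrN, min_self,
        min_eq_right (by omega : r ≤ t), min_eq_right (by omega : N ≤ t)]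
      constructor <;> ring

theorem stepForm_errorCoeff_self (hq : q < 1) {N t s : ℕ} (hst : s < t) (htN : t ≤ N) :
    stepForm q (errorCoeff N t (Sum.inl s)) (errorCoeff N t (Sum.inl s)) =
      expertVariance q t s := by
  have ht0 : (t : ℝ) ≠ 0 := by exact_mod_cast (by omega : t ≠ 0)
  simp only [errorCoeff, signalCoeff, forecast, hst, if_true]
  simp only [map_add, map_sub, map_smul, LinearMap.add_apply, LinearMap.sub_apply,
    LinearMap.smul_apply, stepForm_sumA_sumA, stepForm_sumB_sumB q hq, stepForm_sumA_sumB,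
    stepForm_sumB_sumA, smul_eq_mul, min_eq_left htN, min_eq_right htN, min_eq_left hst.le,
    min_eq_right hst.le, min_eq_left (hst.le.trans htN), min_eq_right (hst.le.trans htN), min_self,
    expertVariance]
  field_simp
  ring

end Form

/-! ### The conditional law of the path given the history -/

section Belief

variable {Ω : Type*}

theorem linearCombination_signalCoeff (N : ℕ) (x : ℝ) (A B : ℕ → Ω → ℝ) (ω : Ω) (σ : Signal) :
    path N x A B ω σ =
      x + Finsupp.linearCombination ℝ (fun i => Sum.elim A B i ω) (signalCoeff N σ) := by
  rcases σ with t | t <;>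
  · simp [path, marketSignal, expertSignal, outcome, signalCoeff, sumA, sumB,
      Finset.sum_add_distrib]
    ring

/-- The error of the expert's forecast of the path of signals. -/
noncomputable def forecastError (N n : ℕ) (x : ℝ) (A B : ℕ → Ω → ℝ) (ω : Ω) : Path :=
  path N x A B ω - forecast N n (path N x A B ω)

/-- The path of signals, if the signals up to the period `n` are those recorded by `h`. -/
noncomputable def continuedPath (N n : ℕ) (x : ℝ) (A B : ℕ → Ω → ℝ) (h : History) (ω : Ω) : Path :=
  forecast N n (recorded h) + forecastError N n x A B ω

theorem forecastError_eq (N n : ℕ) (x : ℝ) (A B : ℕ → Ω → ℝ) (ω : Ω) (σ : Signal) :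
    forecastError N n x A B ω σ =
      Finsupp.linearCombination ℝ (fun i => Sum.elim A B i ω) (errorCoeff N n σ) := by
  have h : path N x A B ω = fun σ =>
      x + Finsupp.linearCombination ℝ (fun i => Sum.elim A B i ω) (signalCoeff N σ) :=
    funext fun σ => linearCombination_signalCoeff N x A B ω σ
  rw [forecastError, h]
  exact sub_forecast_comp_affine N n _ x (signalCoeff N) σ

theorem expertError_add (t s : ℕ) (w w' : Path) :
    expertError t s (w + w') = expertError t s w + expertError t s w' := by
  simp only [expertError, Pi.add_apply]; ring

/-- The forecast made at `n` contributes no error at `t`, so the error is that of the unconditioned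
model and does not depend on `h`. -/
theorem expertError_continuedPath {N n t s : ℕ} (hn : n ≤ N) (hst : s < t) (htn : t ≤ n) (x : ℝ)
    (A B : ℕ → Ω → ℝ) (h : History) (ω : Ω) :
    expertError t s (continuedPath N n x A B h ω) = forecastError N t x A B ω (Sum.inl s) := by
  have h1 := expertError_add t s (forecastError N n x A B ω) (forecast N n (path N x A B ω))
  rw [forecastError, sub_add_cancel, expertError_forecast hn hst htn, add_zero] at h1
  rw [continuedPath, expertError_add, expertError_forecast hn hst htn, zero_add, forecastError,
    ← h1, forecastError]
  simp only [expertError, Pi.sub_apply, forecast, hst, if_true, smul_eq_mul]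
  ring

/-- The right side is a function of the unconditioned history at `t`. Together with
`expertError_continuedPath` this carries the independence of history and error over to the continued
path. -/
theorem history_continuedPath {N n t : ℕ} (hn : n ≤ N) (htn : t ≤ n) (x : ℝ)
    (A B : ℕ → Ω → ℝ) (h : History) (ω : Ω) :
    history N t (continuedPath N n x A B h ω) =
      history N t (forecast N n (recorded h) + (recorded (history N t (path N x A B ω)) -
        forecast N n (recorded (history N t (path N x A B ω))))) := by
  have hf := forecast_recorded_history hn htn (path N x A B ω)
  rw [hf]
  funext s
  by_cases hs : t ≤ s ∧ s ≤ N
  · obtain ⟨h1, h2⟩ := recorded_history (path N x A B ω) hs.1 hs.2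
    generalize recorded (history N t (path N x A B ω)) = g at h1 h2 ⊢
    simp [history, hs, continuedPath, forecastError, h1, h2]
  · simp [history, hs]

variable [MeasurableSpace Ω] {P : Measure Ω} {q : ℝ≥0} {A B : ℕ → Ω → ℝ}

theorem measurable_path (hA : ∀ i, Measurable (A i)) (hB : ∀ i, Measurable (B i)) (N : ℕ) (x : ℝ) :
    Measurable (path N x A B) := by
  refine measurable_pi_iff.2 fun σ => ?_
  rcases σ with t | t <;>
  · simp only [path, marketSignal, expertSignal, outcome, Sum.elim_inl, Sum.elim_inr]
    fun_prop

/-- The steps are independent centered Gaussian variables. -/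
structure IsStepModel (P : Measure Ω) (q : ℝ≥0) (A B : ℕ → Ω → ℝ) : Prop where
  measurable : ∀ i, Measurable (Sum.elim A B i)
  law : ∀ i, P.map (Sum.elim A B i) = gaussianReal 0 (stepVariance q i)
  indep : iIndepFun (Sum.elim A B : ℕ ⊕ ℕ → Ω → ℝ) P

variable (hM : IsStepModel P q A B)
include hM

theorem IsStepModel.measurable_path (N : ℕ) (x : ℝ) : Measurable (path N x A B) :=
  ExpertPrediction.measurable_path (fun i => hM.measurable (Sum.inl i))
    (fun i => hM.measurable (Sum.inr i)) N x

theorem IsStepModel.measurable_forecastError (N n : ℕ) (x : ℝ) :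
    Measurable (forecastError N n x A B) :=
  (hM.measurable_path N x).sub ((measurable_forecast N n).comp (hM.measurable_path N x))

theorem IsStepModel.measurable_continuedPath (N n : ℕ) (x : ℝ) (h : History) :
    Measurable (continuedPath N n x A B h) :=
  measurable_const.add (hM.measurable_forecastError N n x)

theorem IsStepModel.memLp_forecastError (N n : ℕ) (x : ℝ) (σ : Signal) :
    MemLp (fun ω => forecastError N n x A B ω σ) 2 P := by
  simp only [forecastError_eq]
  exact memLp_linearCombination (fun i => hasGaussianLaw_of_map_eq (hM.law i)) _

variable [IsProbabilityMeasure P]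

theorem IsStepModel.indepFun_history_forecastError (hq : q < 1) {N n : ℕ} (x : ℝ) :
    IndepFun (fun ω => history N n (path N x A B ω)) (forecastError N n x A B) P := by
  classical
  have h := indepFun_linearCombination hM.measurable hM.law hM.indep
    -- `σ.elim id id` is the time of the signal; unobserved signals are masked, as in `history`.
    (fun σ : Signal => if n ≤ σ.elim id id ∧ σ.elim id id ≤ N then signalCoeff N σ else 0)
    (errorCoeff N n) (fun k l => by
      change stepForm q _ _ = 0
      split_ifs with h
      · have hsymm : ∀ c d, stepForm q c d = stepForm q d c := fun c d => by
          rw [← covariance_linearCombination hM.measurable hM.law hM.indep, covariance_comm,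
            covariance_linearCombination hM.measurable hM.law hM.indep]
        rw [hsymm]
        rcases k with r | r
        · exact (stepForm_errorCoeff_signalCoeff hq h.1 h.2 l).1
        · exact (stepForm_errorCoeff_signalCoeff hq h.1 h.2 l).2
      · simp)
  have hφ : Measurable (fun (c : Signal → ℝ) (s : ℕ) => if n ≤ s ∧ s ≤ N then
      (x + c (Sum.inl s), x + c (Sum.inr s)) else (0 : ℝ × ℝ)) := by
    refine measurable_pi_iff.2 fun s => ?_
    split_ifs <;> fun_prop
  convert h.comp hφ measurable_id using 1
  · funext ω s
    simp only [history, Function.comp]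
    by_cases hs : n ≤ s ∧ s ≤ N
    · simp [linearCombination_signalCoeff, hs]
    · simp [hs]
  · funext ω σ
    exact forecastError_eq N n x A B ω σ

/-- Given the history, the path is the forecast plus an independent error. -/
theorem IsStepModel.expertBelief_eq (hq : q < 1) {N n : ℕ} (hn : n ≤ N) (x : ℝ) :
    ∀ᵐ h ∂(P.map fun ω => history N n (path N x A B ω)),
      expertBelief P N x A B n h =
        P.map (continuedPath N n x A B h) := by
  have hmeas : Measurable fun p : History × Path => forecast N n (recorded p.1) + p.2 :=
    ((measurable_forecast N n).comp (measurable_recorded.comp measurable_fst)).add measurable_snd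
  have h := condDistrib_ae_eq_map_of_indepFun
    ((measurable_history N n).comp (hM.measurable_path N x)) (hM.measurable_forecastError N n x)
    (hM.indepFun_history_forecastError hq x) hmeas
  have hpath : (fun ω => forecast N n (recorded (history N n (path N x A B ω))) +
      forecastError N n x A B ω) = path N x A B := by
    funext ω
    rw [forecast_recorded_history hn le_rfl, forecastError, add_sub_cancel]
  filter_upwards [h] with h hh
  rw [expertBelief]
  refine Eq.trans ?_ hh
  change _ = condDistrib (fun ω => forecast N n (recorded (history N n (path N x A B ω))) +
    forecastError N n x A B ω) _ P h
  rw [hpath]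
  rfl

theorem IsStepModel.integral_forecastError (N n : ℕ) (x : ℝ) (σ : Signal) :
    ∫ ω, forecastError N n x A B ω σ ∂P = 0 := by
  simp only [forecastError_eq]
  exact integral_linearCombination hM.measurable hM.law _

theorem IsStepModel.integral_forecastError_sq (hq : q < 1) {N t s : ℕ} (hst : s < t) (htN : t ≤ N)
    (x : ℝ) :
    ∫ ω, forecastError N t x A B ω (Sum.inl s) ^ 2 ∂P = expertVariance q t s := by
  have h2 := hM.memLp_forecastError N t x (Sum.inl s)
  rw [← stepForm_errorCoeff_self hq hst htN,
    ← covariance_linearCombination hM.measurable hM.law hM.indep]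
  simp only [← forecastError_eq N t x A B]
  rw [covariance_self h2.aestronglyMeasurable.aemeasurable,
    variance_of_integral_eq_zero h2.aestronglyMeasurable.aemeasurable
      (hM.integral_forecastError N t x _)]

theorem IsStepModel.indepFun_history_expertError (hq : q < 1) {N n t s : ℕ} (hn : n ≤ N)
    (hst : s < t) (htn : t ≤ n) (x : ℝ) (h : History) :
    IndepFun (fun ω => history N t (continuedPath N n x A B h ω))
      (fun ω => expertError t s (continuedPath N n x A B h ω)) P := by
  have hφ : Measurable fun g : History =>
      history N t (forecast N n (recorded h) + (recorded g - forecast N n (recorded g))) :=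
    (measurable_history N t).comp (measurable_const.add (measurable_recorded.sub
      ((measurable_forecast N n).comp measurable_recorded)))
  have hi := (hM.indepFun_history_forecastError hq (N := N) (n := t) x).comp hφ
    (measurable_pi_apply (Sum.inl s : Signal))
  convert hi using 1
  · funext ω
    exact history_continuedPath hn htn x A B h ω
  · funext ω
    exact expertError_continuedPath hn hst htn x A B h ω

theorem IsStepModel.memLp_continuedPath (N n : ℕ) (x : ℝ) (h : History) (σ : Signal) :
    MemLp (fun ω => continuedPath N n x A B h ω σ) 2 P := by
  change MemLp (fun ω => forecast N n (recorded h) σ + forecastError N n x A B ω σ) 2 P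
  exact (memLp_const (forecast N n (recorded h) σ)).add (hM.memLp_forecastError N n x σ)

end Belief

/-! ### Expectations of sums of score differences -/

section Expectation

variable {Ω : Type*} [MeasurableSpace Ω] {P : Measure Ω}

/-- The difference of the logarithmic scores of two Gaussian forecasts: the first has precision
`p` and error `e + d`, the second has variance `τ` and error `e`. -/
noncomputable def scoreGap (τ p d e : ℝ) : ℝ :=
  Real.log p / 2 - p * (e + d) ^ 2 / 2 - (Real.log τ⁻¹ / 2 - τ⁻¹ * e ^ 2 / 2)

theorem log_sub_log_inv_le {τ p : ℝ} (hτ : 0 < τ) (hp : 0 < p) :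
    Real.log p - Real.log τ⁻¹ ≤ p * τ - 1 := by
  rw [Real.log_inv, sub_neg_eq_add, ← Real.log_mul hp.ne' hτ.ne']
  exact Real.log_le_sub_one_of_pos (by positivity)

/-- The bias enters only through a nonpositive square, so the bound holds for arbitrarily wild
announcements. -/
theorem scoreGap_le {τ p d e C : ℝ} (hτ : 0 < τ) (hp : 0 < p) (hC : p ≤ C) :
    scoreGap τ p d e ≤ C * τ / 2 + τ⁻¹ * e ^ 2 / 2 := by
  have h1 := log_sub_log_inv_le hτ hp
  have h2 : 0 ≤ p * (e + d) ^ 2 := by positivity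
  have h3 : p * τ ≤ C * τ := by gcongr
  unfold scoreGap
  linarith

/-- Propriety of the logarithmic score. Freezing `H` by Fubini, the inner integral is (log(pτ) - pτ
+ 1 - p d²)/2, which is nonpositive. Only the mean and variance of `e` matter beyond independence.
-/
theorem integral_scoreGap_nonpos [IsProbabilityMeasure P] {α : Type*} [MeasurableSpace α]
    {H : Ω → α} {e : Ω → ℝ} (hH : Measurable H) (he : Measurable e) (hind : IndepFun H e P)
    (he2 : MemLp e 2 P) (hmean : ∫ ω, e ω ∂P = 0) {τ : ℝ} (hτ : 0 < τ)
    (hvar : ∫ ω, e ω ^ 2 ∂P = τ) {p d : α → ℝ} (hp : Measurable p) (hd : Measurable d)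
    (hp0 : ∀ a, 0 < p a)
    (hint : Integrable (fun ω => scoreGap τ (p (H ω)) (d (H ω)) (e ω)) P) :
    ∫ ω, scoreGap τ (p (H ω)) (d (H ω)) (e ω) ∂P ≤ 0 := by
  have : IsProbabilityMeasure (P.map H) := Measure.isProbabilityMeasure_map hH.aemeasurable
  have : IsProbabilityMeasure (P.map e) := Measure.isProbabilityMeasure_map he.aemeasurable
  set F : α × ℝ → ℝ := fun y => scoreGap τ (p y.1) (d y.1) y.2 with hF
  have hFm : Measurable F := by
    simp only [hF, scoreGap]
    fun_prop
  have hmap := hind.map_prod_eq_prod_map_map hH.aemeasurable he.aemeasurable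
  have h1 : ∫ ω, scoreGap τ (p (H ω)) (d (H ω)) (e ω) ∂P =
      ∫ y, F y ∂((P.map H).prod (P.map e)) := by
    rw [← hmap, integral_map (hH.prodMk he).aemeasurable hFm.aestronglyMeasurable]
  have hFint : Integrable F ((P.map H).prod (P.map e)) := by
    rw [← hmap, integrable_map_measure hFm.aestronglyMeasurable (hH.prodMk he).aemeasurable]
    exact hint
  rw [h1, integral_prod _ hFint]
  refine integral_nonpos fun a => ?_
  have hi1 : Integrable e P := he2.integrable one_le_two
  have hi2 : Integrable (fun ω => e ω ^ 2) P := he2.integrable_sq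
  have h2 : ∫ y, F (a, y) ∂(P.map e) = ∫ ω, F (a, e ω) ∂P :=
    integral_map he.aemeasurable (hFm.comp measurable_prodMk_left).aestronglyMeasurable
  have h3 : (fun ω => F (a, e ω)) = fun ω =>
      (τ⁻¹ / 2 - p a / 2) * e ω ^ 2 + ((-(p a * d a)) * e ω +
        (Real.log (p a) / 2 - Real.log τ⁻¹ / 2 - p a * d a ^ 2 / 2)) := by
    funext ω
    simp only [hF, scoreGap]
    ring
  change ∫ y, F (a, y) ∂(P.map e) ≤ 0
  have hi3 : Integrable (fun ω => -(p a * d a) * e ω +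
      (Real.log (p a) / 2 - Real.log τ⁻¹ / 2 - p a * d a ^ 2 / 2)) P :=
    (hi1.const_mul _).add (integrable_const _)
  rw [h2, h3, integral_add (hi2.const_mul _) hi3, integral_add (hi1.const_mul _) (integrable_const _),
    integral_const_mul, integral_const_mul,
    hmean, hvar, integral_const]
  have h4 := log_sub_log_inv_le hτ (hp0 a)
  have h5 : 0 ≤ p a * d a ^ 2 := mul_nonneg (hp0 a).le (sq_nonneg _)
  have h6 : τ⁻¹ * τ = 1 := inv_mul_cancel₀ hτ.ne'
  simp only [probReal_univ, one_smul]
  nlinarith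

theorem lintegral_ofReal_ne_top_of_le {f g : Ω → ℝ} (hg : Integrable g P) (h : ∀ ω, f ω ≤ g ω) :
    ∫⁻ ω, ENNReal.ofReal (f ω) ∂P ≠ ⊤ :=
  ne_top_of_le_ne_top hg.lintegral_lt_top.ne
    (lintegral_mono fun ω => ENNReal.ofReal_le_ofReal (h ω))

theorem extExpectation_of_integrable {f : Ω → ℝ} (hf : Integrable f P) :
    extExpectation P f = ((∫ ω, f ω ∂P : ℝ) : EReal) := by
  have h1 := hf.lintegral_lt_top.ne
  have h2 := hf.neg.lintegral_lt_top.ne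
  simp only [Pi.neg_apply] at h2
  rw [extExpectation, integral_eq_lintegral_pos_part_sub_lintegral_neg_part hf, EReal.coe_sub,
    EReal.coe_ennreal_toReal h1, EReal.coe_ennreal_toReal h2]

theorem integrable_of_lintegral_ofReal_ne_top {f : Ω → ℝ} (hf : AEStronglyMeasurable f P)
    (h1 : ∫⁻ ω, ENNReal.ofReal (f ω) ∂P ≠ ⊤) (h2 : ∫⁻ ω, ENNReal.ofReal (-f ω) ∂P ≠ ⊤) :
    Integrable f P := by
  refine ⟨hf, ?_⟩
  rw [hasFiniteIntegral_iff_norm]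
  have : ∀ ω, ENNReal.ofReal ‖f ω‖ = ENNReal.ofReal (f ω) + ENNReal.ofReal (-f ω) := by
    intro ω
    rw [Real.norm_eq_abs]
    rcases le_total 0 (f ω) with h | h
    · rw [abs_of_nonneg h, ENNReal.ofReal_of_nonpos (by linarith : -f ω ≤ 0), add_zero]
    · rw [abs_of_nonpos h, ENNReal.ofReal_of_nonpos h, zero_add]
  simp_rw [this]
  rw [lintegral_add_left' hf.aemeasurable.ennreal_ofReal]
  exact ENNReal.add_lt_top.2 ⟨h1.lt_top, h2.lt_top⟩

/-- Meant for `T` the truthful reward and `D` the score gaps, which need not be integrable. Either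
the sum has expectation -∞, or it is integrable, and then the upper bounds `G` force each gap to be
integrable. -/
theorem extExpectation_add_sum_le {ι : Type*} {s : Finset ι} {T : Ω → ℝ} (hT : Integrable T P)
    {D G : ι → Ω → ℝ} (hD : ∀ i ∈ s, Measurable (D i)) (hG : ∀ i ∈ s, Integrable (G i) P)
    (hDG : ∀ i ∈ s, ∀ ω, D i ω ≤ G i ω)
    (hnonpos : ∀ i ∈ s, Integrable (D i) P → ∫ ω, D i ω ∂P ≤ 0) :
    ∫⁻ ω, ENNReal.ofReal (T ω + ∑ i ∈ s, D i ω) ∂P ≠ ⊤ ∧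
      extExpectation P (fun ω => T ω + ∑ i ∈ s, D i ω) ≤ extExpectation P T := by
  classical
  have htop : ∫⁻ ω, ENNReal.ofReal (T ω + ∑ i ∈ s, D i ω) ∂P ≠ ⊤ :=
    lintegral_ofReal_ne_top_of_le (g := fun ω => T ω + ∑ i ∈ s, G i ω)
      (hT.add (integrable_finsetSum _ hG))
      fun ω => add_le_add le_rfl (Finset.sum_le_sum fun i hi => hDG i hi ω)
  refine ⟨htop, ?_⟩
  have hmeas : AEStronglyMeasurable (fun ω => T ω + ∑ i ∈ s, D i ω) P :=
    hT.1.add (Finset.measurable_fun_sum s hD).aestronglyMeasurable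
  by_cases hneg : ∫⁻ ω, ENNReal.ofReal (-(T ω + ∑ i ∈ s, D i ω)) ∂P = ⊤
  · rw [extExpectation, hneg]
    simp
  · have hR := integrable_of_lintegral_ofReal_ne_top hmeas htop hneg
    have hint : ∀ i ∈ s, Integrable (D i) P := by
      intro i hi
      refine integrable_of_lintegral_ofReal_ne_top (hD i hi).aestronglyMeasurable
        (lintegral_ofReal_ne_top_of_le (hG i hi) (hDG i hi)) ?_
      -- With R the whole sum, -D_i = T + ∑_{j≠i} D_j - R, and the other gaps are bounded by their
      -- `G`.
      refine lintegral_ofReal_ne_top_of_le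
        (g := fun ω => ∑ j ∈ s.erase i, G j ω + T ω - (T ω + ∑ j ∈ s, D j ω))
        (((integrable_finsetSum _ fun j hj => hG j (Finset.mem_of_mem_erase hj)).add hT).sub hR)
        fun ω => ?_
      have h1 : ∑ j ∈ s.erase i, D j ω ≤ ∑ j ∈ s.erase i, G j ω :=
        Finset.sum_le_sum fun j hj => hDG j (Finset.mem_of_mem_erase hj) ω
      have h2 := Finset.add_sum_erase s (fun j => D j ω) hi
      linarith
    rw [extExpectation_of_integrable hR, extExpectation_of_integrable hT, EReal.coe_le_coe_iff,
      integral_add hT (integrable_finsetSum _ hint), integral_finsetSum _ hint]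
    have := Finset.sum_nonpos fun i hi => hnonpos i hi (hint i hi)
    linarith

theorem extExpectation_map {α : Type*} [MeasurableSpace α] {X : Ω → α} (hX : Measurable X)
    {R : α → ℝ} (hR : Measurable R) :
    extExpectation (P.map X) R = extExpectation P fun ω => R (X ω) := by
  rw [extExpectation, extExpectation, lintegral_map (by fun_prop) hX,
    lintegral_map (by fun_prop) hX]

end Expectation

/-! ### Comparison of a policy with truthful predictions -/

section Congr

/-- Being determined by the history at a time is expressed as invariance under replacing the path by
the record of that history; this and the `_recorded` lemmas below propagate it. -/
theorem history_recorded {N m t : ℕ} (h : m ≤ t) (w : Path) :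
    history N t (recorded (history N m w)) = history N t w := by
  funext s
  by_cases hs : t ≤ s ∧ s ≤ N
  · simp [history, hs, h.trans hs.1, recorded]
  · simp [history, hs]

variable {N : ℕ} {K : Finset ℕ} {n : ℕ} {past : ℕ → Option ℝ} {σ : Policy}

theorem announcements_recorded {m t : ℕ} (h : m ≤ t) (w : Path) :
    announcements N K n past σ (recorded (history N m w)) t = announcements N K n past σ w t := by
  unfold announcements
  rw [history_recorded h]

theorem announcements_of_notMem {w : Path} : ∀ t ≤ n, t ∉ K →
    announcements N K n past σ w t = none := by
  intro t ht htK
  simp [announcements, not_lt.2 ht, htK]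

theorem announcements_truthful {w : Path} {t : ℕ} (ht : t ≤ n) (htN : t ≤ N) (htK : t ∈ K) :
    announcements N K n past truthful w t = some (w (Sum.inr t)) := by
  simp [announcements, not_lt.2 ht, htK, truthful, history, htN]

theorem heard_congr {a a' : ℕ → Option ℝ} {t : ℕ} (h : ∀ s, t ≤ s → s ≤ N → a s = a' s) :
    heard N a t = heard N a' t := by
  refine Finset.filter_congr fun s hs => ?_
  rw [Finset.mem_Icc] at hs
  rw [h s hs.1 hs.2]

theorem announcedShift_congr (q : ℝ≥0) {S : Finset ℕ} {w w' : Path}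
    (h : ∀ s ∈ S, w (Sum.inl s) = w' (Sum.inl s) ∧ w (Sum.inr s) = w' (Sum.inr s)) :
    announcedShift q S w = announcedShift q S w' := by
  unfold announcedShift
  split_ifs with hS
  · rw [(h _ (S.min'_mem hS)).1, (h _ (S.min'_mem hS)).2]
  · rfl

end Congr

/-! ### Measurability of the total reward -/

section Measurability

variable (N : ℕ) (K : Finset ℕ) (n : ℕ) (past : ℕ → Option ℝ) (σ : Policy)

theorem measurableSet_announcements_isSome (t : ℕ) :
    MeasurableSet {w | (announcements N K n past σ w t).isSome} := by
  by_cases h1 : n < t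
  · simp [announcements, h1]
  · by_cases h2 : t ∈ K
    · have : {w | (announcements N K n past σ w t).isSome} = history N t ⁻¹' σ.speaks t := by
        ext w
        by_cases h3 : history N t w ∈ σ.speaks t <;> simp [announcements, h1, h2, h3]
      rw [this]
      exact measurable_history N t (σ.measurableSet_speaks t)
    · simp [announcements, h1, h2]

theorem measurable_announcements_getD (t : ℕ) :
    Measurable fun w => (announcements N K n past σ w t).getD 0 := by
  classical
  by_cases h1 : n < t
  · simp [announcements, h1]
  · by_cases h2 : t ∈ K
    · have : (fun w => (announcements N K n past σ w t).getD 0) = fun w =>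
          if w ∈ history N t ⁻¹' σ.speaks t then σ.report t (history N t w) else 0 := by
        funext w
        by_cases h3 : history N t w ∈ σ.speaks t <;> simp [announcements, h1, h2, h3]
      rw [this]
      exact Measurable.ite (measurable_history N t (σ.measurableSet_speaks t))
        ((σ.measurable_report t).comp (measurable_history N t)) measurable_const
    · simp [announcements, h1, h2]

theorem measurable_perceived :
    Measurable fun w => perceived w (announcements N K n past σ w) := by
  refine measurable_pi_iff.2 fun τ => ?_
  rcases τ with t | t
  · exact measurable_pi_apply (Sum.inl t : Signal)
  · exact measurable_announcements_getD N K n past σ t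

theorem measurableSet_heard (t : ℕ) (S : Finset ℕ) :
    MeasurableSet {w | heard N (announcements N K n past σ w) t = S} := by
  have : {w | heard N (announcements N K n past σ w) t = S} =
      ⋂ s : ℕ, {w | (t ≤ s ∧ s ≤ N) ∧ (announcements N K n past σ w s).isSome ↔ s ∈ S} := by
    ext w
    simp [heard, Finset.ext_iff]
  rw [this]
  refine MeasurableSet.iInter fun s => ?_
  have h := measurableSet_announcements_isSome N K n past σ s
  by_cases h1 : t ≤ s ∧ s ≤ N <;> by_cases h2 : s ∈ S <;> simp only [h1, h2, true_and, false_and,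
    iff_true, iff_false, Set.ofPred_true, Set.ofPred_false, MeasurableSet.univ,
    MeasurableSet.empty]
  · exact h
  · exact h.compl

theorem measurable_heard_comp {g : Finset ℕ → Path → ℝ} (hg : ∀ S, Measurable (g S)) (t : ℕ) :
    Measurable fun w => g (heard N (announcements N K n past σ w) t) w := by
  -- There are countably many finite sets, so measurability can be checked for each value of the
  -- heard set.
  let _ : MeasurableSpace (Finset ℕ) := ⊤
  have h1 : Measurable fun w => heard N (announcements N K n past σ w) t :=
    measurable_to_countable' fun S => measurableSet_heard N K n past σ t S
  have h2 : Measurable fun y : Finset ℕ × Path => g y.1 y.2 :=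
    measurable_from_prod_countable_right fun S => hg S
  exact h2.comp (h1.prodMk measurable_id)

theorem measurable_announcedShift (q : ℝ≥0) (S : Finset ℕ) : Measurable (announcedShift q S) := by
  unfold announcedShift
  split_ifs <;> fun_prop

theorem measurable_logScore (q : ℝ≥0) (t : ℕ) (S : Finset ℕ) : Measurable (logScore q t S) := by
  have := measurable_announcedShift q S
  unfold logScore marketDensity normalDensity
  split_ifs <;> fun_prop

theorem measurable_totalReward {q : ℝ≥0} (hq : q < 1) (hK : K ⊆ Finset.Icc 1 N) :
    Measurable (totalReward q N K n past σ) := by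
  refine Finset.measurable_fun_sum _ fun t ht => ?_
  have ht := Finset.mem_Icc.1 (hK (Finset.mem_filter.1 ht).1)
  simp only [periodReward_eq hq ht.1 ht.2]
  exact (measurable_heard_comp N K n past σ (fun S =>
      (measurable_logScore q t S).comp (measurable_perceived N K n past σ)) t).sub
    (measurable_heard_comp N K n past σ (fun S =>
      (measurable_logScore q t S).comp (measurable_perceived N K n past σ)) (t + 1))

end Measurability

/-! ### The reward of a policy as the truthful reward plus score gaps -/

section Decomposition

variable (q : ℝ≥0) (N : ℕ) (K : Finset ℕ) (n : ℕ) (past : ℕ → Option ℝ) (σ : Policy)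

/-- The precision that the announcements up to time `t` add to the market's posterior. -/
noncomputable def policyPrecision (t : ℕ) (w : Path) : ℝ :=
  announcedPrecision q (heard N (announcements N K n past σ w) t)

/-- The shift that the announcements up to time `t` add to the market's posterior. -/
noncomputable def policyShift (t : ℕ) (w : Path) : ℝ :=
  announcedShift q (heard N (announcements N K n past σ w) t)
    (perceived w (announcements N K n past σ w))

/-- The precision of the market's forecast of `X_s` after time `t`. -/
noncomputable def policyForecastPrecision (t s : ℕ) (w : Path) : ℝ :=
  forecastPrecision t s (policyPrecision q N K n past σ t w)

/-- The difference between the expert's and the market's forecasts of `X_s` after time `t`. -/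
noncomputable def policyBias (t s : ℕ) (w : Path) : ℝ :=
  s / t * w (Sum.inl t) + (1 - s / t) * w (Sum.inr t) -
    forecastMean t s (policyPrecision q N K n past σ t w) (policyShift q N K n past σ t w)
      (w (Sum.inl t))

theorem measurable_policyPrecision (t : ℕ) : Measurable (policyPrecision q N K n past σ t) :=
  measurable_heard_comp N K n past σ (g := fun S _ => announcedPrecision q S)
    (fun _ => measurable_const) t

theorem measurable_policyShift (t : ℕ) : Measurable (policyShift q N K n past σ t) :=
  measurable_heard_comp N K n past σ (fun S =>
    (measurable_announcedShift q S).comp (measurable_perceived N K n past σ)) t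

theorem measurable_policyForecastPrecision (t s : ℕ) :
    Measurable (policyForecastPrecision q N K n past σ t s) := by
  have := measurable_policyPrecision q N K n past σ t
  unfold policyForecastPrecision forecastPrecision
  fun_prop

theorem measurable_policyBias (t s : ℕ) : Measurable (policyBias q N K n past σ t s) := by
  have := measurable_policyPrecision q N K n past σ t
  have := measurable_policyShift q N K n past σ t
  unfold policyBias forecastMean
  fun_prop

theorem policyPrecision_recorded (t : ℕ) (w : Path) :
    policyPrecision q N K n past σ t (recorded (history N t w)) =
      policyPrecision q N K n past σ t w := by
  rw [policyPrecision, policyPrecision, heard_congr fun s hs _ => announcements_recorded hs w]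

theorem policyShift_recorded (t : ℕ) (w : Path) :
    policyShift q N K n past σ t (recorded (history N t w)) =
      policyShift q N K n past σ t w := by
  rw [policyShift, policyShift, heard_congr fun s hs _ => announcements_recorded hs w]
  refine announcedShift_congr q fun s hs => ?_
  have hs := Finset.mem_Icc.1 (heard_subset _ _ _ hs)
  simp only [perceived, Sum.elim_inl, Sum.elim_inr]
  rw [announcements_recorded hs.1, (recorded_history w hs.1 hs.2).1]
  exact ⟨rfl, rfl⟩

theorem policyForecastPrecision_recorded (t s : ℕ) (w : Path) :
    policyForecastPrecision q N K n past σ t s (recorded (history N t w)) =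
      policyForecastPrecision q N K n past σ t s w := by
  rw [policyForecastPrecision, policyPrecision_recorded, policyForecastPrecision]

theorem policyBias_recorded {t : ℕ} (htN : t ≤ N) (s : ℕ) (w : Path) :
    policyBias q N K n past σ t s (recorded (history N t w)) =
      policyBias q N K n past σ t s w := by
  rw [policyBias, policyPrecision_recorded, policyShift_recorded, policyBias,
    (recorded_history w le_rfl htN).1, (recorded_history w le_rfl htN).2]

variable {q N K n}

theorem announcedPrecision_le (hq : q < 1) (S : Finset ℕ) :
    announcedPrecision q S ≤ q / (1 - q) := by
  have hq1 : (0 : ℝ) < 1 - q := by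
    have : (q : ℝ) < 1 := by exact_mod_cast hq
    linarith
  unfold announcedPrecision
  split_ifs with h
  · rcases Nat.eq_zero_or_pos (S.min' h) with h0 | h0
    · rw [h0]; simp; positivity
    · have : (1 : ℝ) ≤ S.min' h := by exact_mod_cast h0
      exact div_le_div_of_nonneg_left (by positivity) hq1 (le_mul_of_one_le_right hq1.le this)
  · positivity

theorem policyForecastPrecision_pos (hq : q < 1) {t s : ℕ} (hst : s < t) (w : Path) :
    0 < policyForecastPrecision q N K n past σ t s w :=
  forecastPrecision_pos s.cast_nonneg (by exact_mod_cast hst) (announcedPrecision_nonneg hq _)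

theorem policyForecastPrecision_le (hq : q < 1) {t s : ℕ} (hst : s < t) (w : Path) :
    policyForecastPrecision q N K n past σ t s w ≤ (1 + t * (q / (1 - q))) / (t - s) := by
  have hst' : (s : ℝ) < t := by exact_mod_cast hst
  refine (forecastPrecision_le s.cast_nonneg hst' (announcedPrecision_nonneg hq _)).trans ?_
  have : (0 : ℝ) < t - s := by linarith
  have := announcedPrecision_le hq (heard N (announcements N K n past σ w) t)
  gcongr

theorem isLeast_heard_truthful {t : ℕ} (ht : t ≤ n) (htN : t ≤ N) (htK : t ∈ K) (w : Path) :
    IsLeast (heard N (announcements N K n past truthful w) t : Set ℕ) t := by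
  refine ⟨?_, fun s hs => (Finset.mem_Icc.1 (heard_subset _ _ _ hs)).1⟩
  simp [heard, htN, announcements_truthful ht htN htK]

/-- Both rewards are regrouped by `sum_periodReward_eq`. The boundary terms agree because they
involve only announcements made before `n`, and the common scores cancel; what is left compares two
forecasts of the same X_s. -/
theorem totalReward_eq_add_sum_scoreGap (hq : q < 1) (hK : K ⊆ Finset.Icc 1 N) (w : Path) :
    totalReward q N K n past σ w = totalReward q N K n past truthful w +
      ∑ t ∈ K.filter (fun t => t ≤ n), scoreGap (expertVariance q t (nextPeriod K (t - 1)))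
        (policyForecastPrecision q N K n past σ t (nextPeriod K (t - 1)) w)
        (policyBias q N K n past σ t (nextPeriod K (t - 1)) w)
        (expertError t (nextPeriod K (t - 1)) w) := by
  rw [totalReward, totalReward, sum_periodReward_eq hq hK _ _ announcements_of_notMem,
    sum_periodReward_eq hq hK _ _ announcements_of_notMem, add_assoc, ← Finset.sum_add_distrib]
  have hheard : heard N (announcements N K n past σ w) (n + 1) =
      heard N (announcements N K n past truthful w) (n + 1) :=
    heard_congr fun s hs _ => by simp [announcements, Nat.lt_of_succ_le hs]
  congr 1
  · rw [hheard]
    simp only [logScore]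
    rw [announcedShift_congr q (w := perceived w (announcements N K n past σ w))
      (w' := perceived w (announcements N K n past truthful w)) fun s hs => ⟨rfl, by
        have := (Finset.mem_Icc.1 (heard_subset _ _ _ hs)).1
        simp [perceived, announcements, Nat.lt_of_succ_le this]⟩]
    rfl
  · refine Finset.sum_congr rfl fun t ht => ?_
    obtain ⟨htK, htn⟩ := Finset.mem_filter.1 ht
    have htN := Finset.mem_Icc.1 (hK htK)
    have hst : nextPeriod K (t - 1) < t := by
      have := nextPeriod_le K (t - 1); omega
    set s := nextPeriod K (t - 1)
    rw [logScore_sub_logScore hq hst, logScore_sub_logScore hq hst]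
    obtain ⟨h1, h2⟩ := forecast_of_isLeast hq hst
      (isLeast_heard_truthful past htn htN.2 htK w)
      (perceived w (announcements N K n past truthful w))
    have h3 : expertError t s (perceived w (announcements N K n past truthful w)) =
        expertError t s w := by
      simp [expertError, perceived, announcements_truthful htn htN.2 htK]
    have h4 : w (Sum.inl s) - forecastMean t s (policyPrecision q N K n past σ t w)
        (policyShift q N K n past σ t w) (w (Sum.inl t)) =
        expertError t s w + policyBias q N K n past σ t s w := by
      simp only [expertError, policyBias]; ring
    rw [h1, h2, h3]
    simp only [scoreGap, policyForecastPrecision, ← h4, policyPrecision, policyShift, perceived,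
      Sum.elim_inl]
    ring

end Decomposition

/-! ### Integrability of the truthful reward -/

section Integrability

variable {Ω : Type*} [MeasurableSpace Ω] {P : Measure Ω} [IsProbabilityMeasure P]

theorem integrable_logScore {q : ℝ≥0} (hq : q < 1) (t : ℕ) (S : Finset ℕ) {W : Ω → Path}
    (hX : ∀ s, MemLp (fun ω => W ω (Sum.inl s)) 2 P)
    (hY : ∀ s, MemLp (fun ω => W ω (Sum.inr s)) 2 P) :
    Integrable (fun ω => logScore q t S (W ω)) P := by
  rcases Nat.eq_zero_or_pos t with rfl | ht
  · simp [logScore]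
  · have ht' : (0 : ℝ) < t := by exact_mod_cast ht
    have hp : 0 < 1 / (t : ℝ) + announcedPrecision q S :=
      add_pos_of_pos_of_nonneg (by positivity) (announcedPrecision_nonneg hq S)
    have hshift : MemLp (fun ω => announcedShift q S (W ω)) 2 P := by
      unfold announcedShift
      split_ifs with h
      · simp only [div_eq_mul_inv]
        exact ((hY _).mul_const _).sub ((hX _).mul_const _)
      · exact memLp_const 0
    have hm : MemLp (fun ω => W ω (Sum.inl 0) - (W ω (Sum.inl t) / t + announcedShift q S (W ω)) /
        (1 / t + announcedPrecision q S)) 2 P := by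
      simp only [div_eq_mul_inv]
      exact (hX 0).sub ((((hX t).mul_const _).add hshift).mul_const _)
    have hne : t ≠ 0 := by omega
    simp only [logScore, hne, if_false, marketDensity, log_normalDensity hp]
    exact (integrable_const _).sub ((hm.integrable_sq.const_mul _).div_const _)

variable {q : ℝ≥0} {N : ℕ} {K : Finset ℕ} {n : ℕ}

theorem integrable_totalReward_truthful (hq : q < 1) (hK : K ⊆ Finset.Icc 1 N) (hn : n ≤ N)
    (past : ℕ → Option ℝ) {W : Ω → Path} (hW : ∀ σ, MemLp (fun ω => W ω σ) 2 P) :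
    Integrable (fun ω => totalReward q N K n past truthful (W ω)) P := by
  -- Under truthful predictions the times of the announcements do not depend on the path, so each
  -- score has a fixed precision and is quadratic in square-integrable signals.
  have hheard : ∀ w t, heard N (announcements N K n past truthful w) t =
      heard N (announcements N K n past truthful 0) t := by
    intro w t
    refine Finset.filter_congr fun s _ => ?_
    by_cases h1 : n < s <;> by_cases h2 : s ∈ K <;> simp [announcements, truthful, h1, h2]
  have hY : ∀ s, MemLp (fun ω => perceived (W ω) (announcements N K n past truthful (W ω))
      (Sum.inr s)) 2 P := by
    intro s
    simp only [perceived, Sum.elim_inr]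
    by_cases h1 : n < s
    · simpa [announcements, h1] using memLp_const _
    · by_cases h2 : s ∈ K
      · have h3 : s ≤ N := by omega
        simpa [announcements_truthful (not_lt.1 h1) h3 h2] using hW _
      · simp [announcements, h1, h2]
  refine integrable_finsetSum _ fun t ht => ?_
  have ht := Finset.mem_Icc.1 (hK (Finset.mem_filter.1 ht).1)
  simp only [periodReward_eq hq ht.1 ht.2, hheard]
  have hint := fun S => integrable_logScore hq t S
    (W := fun ω => perceived (W ω) (announcements N K n past truthful (W ω)))
    (fun s => hW (Sum.inl s)) hY
  exact (hint _).sub (hint _)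

end Integrability

/-! ### Optimality of truthful predictions -/

section Optimality

variable {Ω : Type*} [MeasurableSpace Ω] {P : Measure Ω} [IsProbabilityMeasure P]
  {q : ℝ≥0} {A B : ℕ → Ω → ℝ} {N : ℕ} {K : Finset ℕ} {n : ℕ}

theorem IsStepModel.totalReward_le_truthful (hM : IsStepModel P q A B) (hq : q < 1)
    (hK : K ⊆ Finset.Icc 1 N) (hn : n ≤ N) (x : ℝ) (h : History) (past : ℕ → Option ℝ) :
    Integrable (totalReward q N K n past truthful) (P.map (continuedPath N n x A B h)) ∧
      ∀ σ : Policy,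
        ∫⁻ w, ENNReal.ofReal (totalReward q N K n past σ w)
          ∂(P.map (continuedPath N n x A B h)) ≠ ⊤ ∧
        extExpectation (P.map (continuedPath N n x A B h)) (totalReward q N K n past σ) ≤
          extExpectation (P.map (continuedPath N n x A B h))
            (totalReward q N K n past truthful) := by
  set W := continuedPath N n x A B h with hWdef
  have hWm : Measurable W := hM.measurable_continuedPath N n x h
  have hW2 : ∀ σ, MemLp (fun ω => W ω σ) 2 P := hM.memLp_continuedPath N n x h
  have hR := fun σ => measurable_totalReward N K n past σ hq hK
  have hT := integrable_totalReward_truthful hq hK hn past hW2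
  refine ⟨(integrable_map_measure (hR _).aestronglyMeasurable hWm.aemeasurable).2 hT, fun σ => ?_⟩
  rw [lintegral_map (hR σ).ennreal_ofReal hWm, extExpectation_map hWm (hR _),
    extExpectation_map hWm (hR _)]
  simp only [totalReward_eq_add_sum_scoreGap past σ hq hK]
  have herr : ∀ t s, Measurable fun ω => expertError t s (W ω) := fun t s => by
    unfold expertError
    fun_prop
  have hper : ∀ t ∈ K.filter (fun t => t ≤ n), t ≤ n ∧ nextPeriod K (t - 1) < t := by
    intro t ht
    obtain ⟨htK, htn⟩ := Finset.mem_filter.1 ht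
    have htN := Finset.mem_Icc.1 (hK htK)
    have := nextPeriod_le K (t - 1)
    exact ⟨htn, by omega⟩
  have herr_eq : ∀ t s, s < t → t ≤ n → ∀ ω, expertError t s (W ω) =
      forecastError N t x A B ω (Sum.inl s) := fun t s hst htn ω =>
    expertError_continuedPath hn hst htn x A B h ω
  have herr2 : ∀ t s, s < t → t ≤ n → MemLp (fun ω => expertError t s (W ω)) 2 P := by
    intro t s hst htn
    simp only [herr_eq t s hst htn]
    exact hM.memLp_forecastError N t x _
  refine extExpectation_add_sum_le hT
    (G := fun t ω => (1 + t * (q / (1 - q))) / (t - nextPeriod K (t - 1)) *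
        expertVariance q t (nextPeriod K (t - 1)) / 2 +
      (expertVariance q t (nextPeriod K (t - 1)))⁻¹ *
        expertError t (nextPeriod K (t - 1)) (W ω) ^ 2 / 2)
    (fun t _ => ?_) (fun t ht => ?_) (fun t ht ω => ?_) (fun t ht hint => ?_)
  · have h1 := (measurable_policyForecastPrecision q N K n past σ t (nextPeriod K (t - 1))).comp hWm
    have h2 := (measurable_policyBias q N K n past σ t (nextPeriod K (t - 1))).comp hWm
    have h3 := herr t (nextPeriod K (t - 1))
    simp only [Function.comp_def] at h1 h2
    unfold scoreGap
    fun_prop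
  · obtain ⟨htn, hst⟩ := hper t ht
    exact (integrable_const _).add
      (((herr2 t _ hst htn).integrable_sq.const_mul _).div_const _)
  · obtain ⟨htn, hst⟩ := hper t ht
    exact scoreGap_le (expertVariance_pos hq hst) (policyForecastPrecision_pos past σ hq hst _)
      (policyForecastPrecision_le past σ hq hst _)
  · obtain ⟨htn, hst⟩ := hper t ht
    set s := nextPeriod K (t - 1)
    -- The market's precision and the bias are functions of the history at `t`, which is independent
    -- of the expert's error.
    have hrec : ∀ ω, scoreGap (expertVariance q t s)
        (policyForecastPrecision q N K n past σ t s (W ω))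
        (policyBias q N K n past σ t s (W ω)) (expertError t s (W ω)) =
        scoreGap (expertVariance q t s)
          (policyForecastPrecision q N K n past σ t s (recorded (history N t (W ω))))
          (policyBias q N K n past σ t s (recorded (history N t (W ω))))
          (expertError t s (W ω)) := fun ω => by
      rw [policyForecastPrecision_recorded, policyBias_recorded q N K n past σ (htn.trans hn)]
    simp only [hrec] at hint ⊢
    refine integral_scoreGap_nonpos (H := fun ω => history N t (W ω))
      (p := fun g => policyForecastPrecision q N K n past σ t s (recorded g))
      (d := fun g => policyBias q N K n past σ t s (recorded g))
      ((measurable_history N t).comp hWm) (herr t s)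
      (hM.indepFun_history_expertError hq hn hst htn x h) (herr2 t s hst htn) ?_
      (expertVariance_pos hq hst) ?_
      ((measurable_policyForecastPrecision q N K n past σ t s).comp measurable_recorded)
      ((measurable_policyBias q N K n past σ t s).comp measurable_recorded)
      (fun g => policyForecastPrecision_pos past σ hq hst _) hint
    · simp only [herr_eq t s hst htn]
      exact hM.integral_forecastError N t x _
    · simp only [herr_eq t s hst htn]
      exact hM.integral_forecastError_sq hq hst (htn.trans hn) x

end Optimality

end ExpertPrediction

theorem theorem1
    {Ω : Type*} [MeasurableSpace Ω] (P : Measure Ω) [IsProbabilityMeasure P]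
    -- quality of the expert, number of periods, allowed periods
    (q : ℝ≥0) (hq : q < 1) (N : ℕ) (K : Finset ℕ) (hK : K ⊆ Finset.Icc 1 N)
    -- the two components of the random-walk steps
    (A B : ℕ → Ω → ℝ)
    (hA : ∀ i, Measurable (A i)) (hB : ∀ i, Measurable (B i))
    (hAlaw : ∀ i, P.map (A i) = gaussianReal 0 q)
    (hBlaw : ∀ i, P.map (B i) = gaussianReal 0 (1 - q))
    (hindep : iIndepFun (Sum.elim A B : ℕ ⊕ ℕ → Ω → ℝ) P)
    -- the market price at the initial period, the current period
    (x : ℝ) (n : ℕ) (hn : n ≤ N) :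
    -- for almost every history `h` of signals up to period `n`
    ∀ᵐ h ∂(P.map fun ω => history N n (path N x A B ω)),
      -- and every record of announcements before period `n`
      ∀ past : ℕ → Option ℝ,
        Integrable (totalReward q N K n past truthful) (expertBelief P N x A B n h) ∧
        ∀ σ : Policy,
          -- the expected total reward of `σ` is well defined in `[-∞, ∞)`
          ∫⁻ w, ENNReal.ofReal (totalReward q N K n past σ w) ∂(expertBelief P N x A B n h) ≠ ⊤ ∧
          -- and at most that of truthful predictions at all allowed periods
          extExpectation (expertBelief P N x A B n h) (totalReward q N K n past σ)
            ≤ extExpectation (expertBelief P N x A B n h) (totalReward q N K n past truthful) := by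
  have hM : IsStepModel P q A B :=
    ⟨fun i => i.casesOn hA hB, fun i => i.casesOn hAlaw hBlaw, hindep⟩
  -- The exceptional null set comes only from the conditional law, so it serves all `past` and all
  -- policies at once.
  filter_upwards [hM.expertBelief_eq hq hn x] with h hh past
  rw [hh]
  exact hM.totalReward_le_truthful hq hK hn x h past
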